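/- **Definitions.** Let $\nu$ be a non-degenerate probability measure on $\mathbb{R}$ and, for real $\theta$, put $M_\nu(\theta)=\int\frac{1}{1-\theta x}\,\nu(dx)$ and $P_{(\theta,\nu)}(dx)=\frac{1}{M_\nu(\theta)(1-\theta x)}\,\nu(dx)$. If $\operatorname{supp}\nu$ is bounded from above, let $1/\theta_+=\max\{0,\sup\operatorname{supp}\nu\}$; the Cauchy–Stieltjes kernel (CSK) family $\mathcal K_+(\nu)$ is $\{P_{(\theta,\nu)}:0<\theta<\theta_+\}$. If $\operatorname{supp}\nu$ is bounded from below, let $1/\theta_-=\min\{0,\inf\operatorname{supp}\nu\}$; the family $\mathcal K_-(\nu)$ is $\{P_{(\theta,\nu)}:\theta_-<\theta<0\}$ (with $\theta_+=+\infty$, resp. $\theta_-=-\infty$, when the right-hand side is $0$). If $\nu$ is compactly supported, the two-sided CSK family is $\mathcal K(\nu)=\mathcal K_-(\nu)\cup\{\nu\}\cup\mathcal K_+(\nu)$. In each case the mean $k_\nu(\theta)=\int x\,P_{(\theta,\nu)}(dx)$ is strictly increasing in $\theta$; its range is the domain of means, $Q_{(m,\nu)}$ denotes the member of the family with mean $m$,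 and the variance function of the family is $V_\nu(m)=\int (x-m)^2\,Q_{(m,\nu)}(dx)$. **Corollary.** Let $V$ be a real-valued function that is analytic at $0$, with $V(0)=1$. The following are equivalent. (i) There is a compactly supported probability measure $\nu$ with mean $0$ and variance $1$ such that $V$ is the variance function of the two-sided CSK family $\mathcal K(\nu)$ near $0$ (that is, all $m$ in some open interval around $0$ belong to the domain of means and satisfy $V(m)=V_\nu(m)$). (i$_+$) There is a probability measure $\nu$ with support bounded from above, mean $0$ and variance $1$ such that $V$ is the variance function of $\mathcal K_+(\nu)$ near $0$ (that is, all $m$ in some interval $(0,\varepsilon)$, $\varepsilon>0$, belong to the domain of means and satisfy $V(m)=V_\nu(m)$). (i$_-$) There is a probability measure $\nu$ with support bounded from below, mean $0$ and variance $1$ such that $V$ is the variance function of $\mathcal K_-(\nu)$ near $0$ (the same on some interval $(-\varepsilon,0)$). (ii) There is a finite positive Borel measure $\rho$ on $\mathbb{R}$, all of whose moments are finite, such that $$\int x^{n-1}\,\rho(dx)=\frac{1}{n!}\left.\frac{d^{n-1}}{dm^{n-1}}\bigl(V(m)+m^2\bigr)^n\right|_{m=0}\qquad\text{for all } n\ge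 1 .$$ -/

import Mathlib

open MeasureTheory ProbabilityTheory Filter Topology Set

noncomputable section

namespace CSK

/-- `M_ν(θ) = ∫ 1 / (1 - θ x) ν(dx)`. -/
def M (ν : Measure ℝ) (θ : ℝ) : ℝ := ∫ x, 1 / (1 - θ * x) ∂ν

/-- `P_{(θ,ν)}(dx) = 1 / (M_ν(θ) (1 - θ x)) ν(dx)`. -/
def P (ν : Measure ℝ) (θ : ℝ) : Measure ℝ :=
  ν.withDensity fun x => ENNReal.ofReal (1 / (M ν θ * (1 - θ * x)))

/-- `B(ν) = max {0, sup supp ν}`, meaningful when the support is bounded from above. -/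
def B (ν : Measure ℝ) : ℝ := max 0 (sSup ν.support)

/-- `A(ν) = min {0, inf supp ν}`, meaningful when the support is bounded from below. -/
def A (ν : Measure ℝ) : ℝ := min 0 (sInf ν.support)

/-- The parameter interval `(0, θ₊)` of `K₊(ν)`, with `1 / θ₊ = B(ν)` (`θ₊ = ∞` if `B(ν) = 0`). -/
def thetaRight (ν : Measure ℝ) : Set ℝ := {θ | 0 < θ ∧ θ * B ν < 1}

/-- The parameter interval `(θ₋, 0)` of `K₋(ν)`, with `1 / θ₋ = A(ν)` (`θ₋ = -∞` if `A(ν) = 0`). -/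
def thetaLeft (ν : Measure ℝ) : Set ℝ := {θ | θ < 0 ∧ θ * A ν < 1}

/-- The parameter interval `(θ₋, θ₊)` of the two-sided family
`K(ν) = K₋(ν) ∪ {ν} ∪ K₊(ν)`. -/
def thetaTwoSided (ν : Measure ℝ) : Set ℝ := thetaLeft ν ∪ {0} ∪ thetaRight ν

/-- The mean `k_ν(θ) = ∫ x P_{(θ,ν)}(dx)`. -/
def k (ν : Measure ℝ) (θ : ℝ) : ℝ := ∫ x, x ∂(P ν θ)

/-- The domain of means of the family `{P_{(θ,ν)} : θ ∈ Θ}`. -/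
def domainOfMeans (Θ : Set ℝ) (ν : Measure ℝ) : Set ℝ := k ν '' Θ

/-- `ψ_ν`, the inverse of `k_ν : Θ → domainOfMeans Θ ν`. -/
def psi (Θ : Set ℝ) (ν : Measure ℝ) (m : ℝ) : ℝ := Function.invFunOn (k ν) Θ m

/-- `Q_{(m,ν)}`, the member with mean `m` of the family `{P_{(θ,ν)} : θ ∈ Θ}`. -/
def Q (Θ : Set ℝ) (ν : Measure ℝ) (m : ℝ) : Measure ℝ := P ν (psi Θ ν m)

/-- The variance function `V_ν(m) = ∫ (x - m)² Q_{(m,ν)}(dx)`. -/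
def varianceFunction (Θ : Set ℝ) (ν : Measure ℝ) (m : ℝ) : ℝ :=
  ∫ x, (x - m) ^ 2 ∂(Q Θ ν m)

/-- All `m` close to the limit point of `l` lie in the domain of means, and
`V` is there the variance function of the family `{P_{(θ,ν)} : θ ∈ Θ}`. -/
def IsVarianceFunctionAlong (l : Filter ℝ) (Θ : Set ℝ) (ν : Measure ℝ) (V : ℝ → ℝ) : Prop :=
  ∀ᶠ m in l, m ∈ domainOfMeans Θ ν ∧ V m = varianceFunction Θ ν m

/-- `ν` is compactly supported and `V` is, on an open interval around the mean of `ν`,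
the variance function of the two-sided family `K(ν)`. -/
def IsVarianceFunctionTwoSided (ν : Measure ℝ) (V : ℝ → ℝ) : Prop :=
  IsCompact ν.support ∧ IsVarianceFunctionAlong (𝓝 (∫ x, x ∂ν)) (thetaTwoSided ν) ν V

/-- `ν` has support bounded from above and `V` is, on an interval `(m₀, m₀ + ε)` where `m₀` is
the mean of `ν`, the variance function of `K₊(ν)`. -/
def IsVarianceFunctionRight (ν : Measure ℝ) (V : ℝ → ℝ) : Prop :=
  BddAbove ν.support ∧ IsVarianceFunctionAlong (𝓝[>] (∫ x, x ∂ν)) (thetaRight ν) ν V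

/-- `ν` has support bounded from below and `V` is, on an interval `(m₀ - ε, m₀)` where `m₀` is
the mean of `ν`, the variance function of `K₋(ν)`. -/
def IsVarianceFunctionLeft (ν : Measure ℝ) (V : ℝ → ℝ) : Prop :=
  BddBelow ν.support ∧ IsVarianceFunctionAlong (𝓝[<] (∫ x, x ∂ν)) (thetaLeft ν) ν V

/-- `ν` is a probability measure with mean `0` and variance `1`. -/
def IsStandardized (ν : Measure ℝ) : Prop :=
  IsProbabilityMeasure ν ∧ MemLp id 2 ν ∧ ∫ x, x ∂ν = 0 ∧ Var[id; ν] = 1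

end CSK

end

/-! Put `W m = V m + m ^ 2`. For a standardized `ν`, integrating `1/(1 - θx) = 1 + θx/(1 - θx)`
against `1` and against `x` gives `M ν θ * (1 - θ * k ν θ) = 1` and `θ * W m = m` for `m = k ν θ`,
where `V m` is the variance of `P ν θ`. So being a variance function near `0` amounts to `k ν` being
the local inverse `κ` of `m ↦ m / W m` on the relevant side of `0`.

By Lagrange inversion (`iteratedDeriv_succ_of_leftInverse`) the right-hand side of (ii) is the
`n`-th Taylor coefficient of `κ`. Hence (ii) says that `κ θ = θ * M ρ θ` near `0`; geometric growth
of the coefficients forces `ρ` to have compact support. The first identity then reads `M ν = 1 + θ²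
* M ν * M ρ`.

It remains to pair centered `ν` with `ρ` through this equation. Both constructions are
operator-theoretic: for a self-adjoint `A = T + |e⟩⟨v| + |v⟩⟨e|` with `T e = 0`, `e` a unit vector
and `v ⟂ e`, the spectral measures of `A` at `e` and of `T` at `v` satisfy it
(`inner_pow_add_two_eq_sum`). From `ν`, remove the rank-one terms from multiplication by `x`; from
`ρ`, add a dimension and put them in.

In the one-sided cases `M ν` agrees on one side of `0` with the analytic function `(1 - θ * κ θ)⁻¹`.
This bounds all moments of `ν` geometrically, so `ν` is compactly supported
(`exists_compact_support_of_analytic_right`), and the identity theorem carries the equation across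
`0`. -/

namespace CSK

/-! ### Spectral measures of bounded self-adjoint operators -/

section SpectralMeasure

variable {H : Type*} [NormedAddCommGroup H] [InnerProductSpace ℂ H] [CompleteSpace H]

/-- The positive functional `f ↦ re ⟪v, f(a) v⟫` on the continuous functions on the spectrum of a
self-adjoint operator `a`. -/
noncomputable def spectralFunctional (a : H →L[ℂ] H) (ha : IsSelfAdjoint a) (v : H) :
    CompactlySupportedContinuousMap (spectrum ℝ a) ℝ →ₚ[ℝ] ℝ where
  toFun f := (inner ℂ v (cfcHom (R := ℝ) ha (f : C(spectrum ℝ a, ℝ)) v)).re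
  map_add' f g := by
    have : ((f + g : CompactlySupportedContinuousMap (spectrum ℝ a) ℝ) : C(spectrum ℝ a, ℝ))
        = (f : C(spectrum ℝ a, ℝ)) + (g : C(spectrum ℝ a, ℝ)) := rfl
    rw [this, map_add]
    simp
  map_smul' c f := by
    have : ((c • f : CompactlySupportedContinuousMap (spectrum ℝ a) ℝ) : C(spectrum ℝ a, ℝ))
        = c • (f : C(spectrum ℝ a, ℝ)) := rfl
    rw [this, map_smul, smul_apply, inner_smul_right_eq_smul]
    simp
  monotone' f g hfg := by
    -- Positivity: `g - f = s²`, and `⟪v, s(a)² v⟫ = ‖s(a) v‖²` because `s(a)` is self-adjoint.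
    set s : C(spectrum ℝ a, ℝ) := ⟨fun x => √(g x - f x), by fun_prop⟩ with hs
    have h1 : (g : C(spectrum ℝ a, ℝ)) = (f : C(spectrum ℝ a, ℝ)) + s * s := by
      ext x
      have := hfg x
      simp only [ContinuousMap.add_apply, ContinuousMap.mul_apply, hs, ContinuousMap.coe_mk]
      rw [Real.mul_self_sqrt (sub_nonneg.2 this)]
      change g x = f x + _
      ring
    have h2 : IsSelfAdjoint (cfcHom (R := ℝ) ha s) := cfcHom_predicate ha s
    have h3 : inner ℂ v ((cfcHom (R := ℝ) ha s) ((cfcHom (R := ℝ) ha s) v))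
        = inner ℂ (cfcHom (R := ℝ) ha s v) (cfcHom (R := ℝ) ha s v) := by
      rw [← ContinuousLinearMap.adjoint_inner_left,
        ContinuousLinearMap.isSelfAdjoint_iff'.1 h2]
    simp only
    rw [h1, map_add, map_mul, add_apply, mul_apply_eq_comp,
      inner_add_right, h3, Complex.add_re]
    have := inner_self_nonneg (𝕜 := ℂ) (x := cfcHom (R := ℝ) ha s v)
    simp only [RCLike.re_to_complex] at this
    linarith

/-- The spectral measure of a self-adjoint operator at a vector. -/
theorem exists_measure_moments_eq (a : H →L[ℂ] H) (ha : IsSelfAdjoint a) (v : H) :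
    ∃ μ : Measure ℝ, IsFiniteMeasure μ ∧ μ (Icc (-‖a‖) ‖a‖)ᶜ = 0 ∧
      ∀ n : ℕ, ∫ x, x ^ n ∂μ = (inner ℂ v ((a ^ n) v)).re := by
  -- The Riesz–Markov–Kakutani measure lives on the spectrum, which lies in `[-‖a‖, ‖a‖]`; it is
  -- pushed forward to `ℝ`.
  refine ⟨(RealRMK.rieszMeasure (spectralFunctional a ha v)).map Subtype.val, ?_, ?_, ?_⟩
  · infer_instance
  · rw [Measure.map_apply measurable_subtype_coe measurableSet_Icc.compl]
    convert measure_empty (μ := RealRMK.rieszMeasure (spectralFunctional a ha v))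
    ext ⟨x, hx⟩
    simp only [mem_preimage, mem_compl_iff, mem_Icc, mem_empty_iff_false, iff_false, not_not]
    have := spectrum.norm_le_norm_mul_of_mem hx
    rcases subsingleton_or_nontrivial H with h | h
    · exact absurd hx (by rw [spectrum.of_subsingleton]; simp)
    · rw [norm_one, mul_one] at this
      exact abs_le.1 this
  · intro n
    rw [integral_map measurable_subtype_coe.aemeasurable (by fun_prop)]
    set p : C(spectrum ℝ a, ℝ) := ((ContinuousMap.id ℝ).restrict (spectrum ℝ a)) ^ n with hp
    have h := RealRMK.integral_rieszMeasure (spectralFunctional a ha v)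
      (CompactlySupportedContinuousMap.continuousMapEquiv p)
    have h2 : spectralFunctional a ha v (CompactlySupportedContinuousMap.continuousMapEquiv p)
      = (inner ℂ v (cfcHom (R := ℝ) ha p v)).re := rfl
    rw [h2, hp, map_pow (cfcHom (R := ℝ) ha), cfcHom_id] at h
    exact h

end SpectralMeasure

/-! ### Moments under a rank-one coupling -/

section RankOne

variable {H : Type*} [NormedAddCommGroup H] [InnerProductSpace ℂ H]

/-- The moments of `T + |e⟩⟨v| + |v⟩⟨e|` at `e` in terms of those of `T` at `v`. -/
theorem inner_pow_add_two_eq_sum (A T : H →L[ℂ] H) (e v : H) (he : inner ℂ e e = (1 : ℂ))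
    (hev : inner ℂ e v = (0 : ℂ)) (hTe : T e = 0) (hT : ∀ y, inner ℂ e (T y) = (0 : ℂ))
    (hA : ∀ y, A y = T y + inner ℂ v y • e + inner ℂ e y • v) (n : ℕ) :
    inner ℂ e ((A ^ (n + 2)) e) = ∑ j ∈ Finset.range (n + 1),
      inner ℂ e ((A ^ j) e) * inner ℂ v ((T ^ (n - j)) v) := by
  have hve : inner ℂ v e = (0 : ℂ) := by rw [← inner_conj_symm, hev, map_zero]
  have heA : ∀ y, inner ℂ e (A y) = inner ℂ v y := fun y => by
    rw [hA, inner_add_right, inner_add_right, hT, inner_smul_right, inner_smul_right, he, hev]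
    simp
  -- Each `A ^ n e` splits into its `e`-component and vectors of the `T`-orbit of `v`; a new `v`
  -- enters at each step with weight the current `e`-component.
  have key : ∀ n, (A ^ n) e = inner ℂ e ((A ^ n) e) • e +
      ∑ j ∈ Finset.range n, inner ℂ e ((A ^ j) e) • (T ^ (n - 1 - j)) v := by
    intro n
    induction n with
    | zero =>
      rw [pow_zero, one_apply_eq_self, he]
      simp
    | succ n ih =>
      have h1 : (A ^ (n + 1)) e = A ((A ^ n) e) := by rw [pow_succ']; rfl
      have h2 : T ((A ^ n) e) =
          ∑ j ∈ Finset.range n, inner ℂ e ((A ^ j) e) • (T ^ (n - j)) v := by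
        conv_lhs => rw [ih]
        rw [map_add, map_smul, hTe, smul_zero, zero_add, map_sum]
        refine Finset.sum_congr rfl fun j hj => ?_
        rw [map_smul, ← mul_apply_eq_comp, ← pow_succ']
        congr 3
        have := Finset.mem_range.1 hj
        omega
      rw [h1, heA, hA, h2, Finset.sum_range_succ]
      simp only [Nat.add_sub_cancel, Nat.sub_self, pow_zero, one_apply_eq_self]
      abel
  rw [show n + 2 = (n + 1) + 1 from rfl, pow_succ', mul_apply_eq_comp, heA, key (n + 1),
    inner_add_right, inner_smul_right, hve, mul_zero, zero_add, inner_sum]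
  exact Finset.sum_congr rfl fun j _ => by rw [inner_smul_right]; rfl

theorem isSelfAdjoint_rankOne_add [CompleteSpace H] (e v : H) :
    IsSelfAdjoint (InnerProductSpace.rankOne ℂ e v + InnerProductSpace.rankOne ℂ v e) := by
  rw [ContinuousLinearMap.isSelfAdjoint_iff', map_add, InnerProductSpace.adjoint_rankOne,
    InnerProductSpace.adjoint_rankOne, add_comm]

end RankOne

/-! ### Multiplication operators and the correspondence between `ν` and `ρ` -/

/-- Multiplication by a bounded measurable real function on `L²(μ)`. -/
theorem exists_mul_operator (μ : Measure ℝ) (h : ℝ → ℝ) (hm : Measurable h) (C : ℝ)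
    (hC : ∀ᵐ x ∂μ, |h x| ≤ C) :
    ∃ X : Lp ℂ 2 μ →L[ℂ] Lp ℂ 2 μ, IsSelfAdjoint X ∧
      ∀ f, X f =ᵐ[μ] fun x => (h x : ℂ) * f x := by
  have hL : MemLp (fun x => (h x : ℂ)) ⊤ μ :=
    memLp_top_of_bound (by fun_prop) C (by simpa using hC)
  set X := (ContinuousLinearMap.mul ℂ ℂ).holderL μ ⊤ 2 2 hL.toLp
  have hX : ∀ f, X f =ᵐ[μ] fun x => (h x : ℂ) * f x := fun f => by
    have := (ContinuousLinearMap.mul ℂ ℂ).coeFn_holder (r := 2) hL.toLp f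
    filter_upwards [this, hL.coeFn_toLp] with x h1 h2
    change (ContinuousLinearMap.holder 2 (ContinuousLinearMap.mul ℂ ℂ) hL.toLp f) x = _
    rw [h1, h2]; rfl
  refine ⟨X, ?_, hX⟩
  rw [ContinuousLinearMap.isSelfAdjoint_iff_isSymmetric]
  intro f g
  rw [L2.inner_def, L2.inner_def]
  refine integral_congr_ae ?_
  filter_upwards [hX f, hX g] with x h1 h2
  simp only [ContinuousLinearMap.coe_coe, h1, h2, RCLike.inner_apply, map_mul, Complex.conj_ofReal]
  ring

theorem coeFn_pow_mul_operator {μ : Measure ℝ} {h : ℝ → ℝ} {X : Lp ℂ 2 μ →L[ℂ] Lp ℂ 2 μ}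
    (hX : ∀ f, X f =ᵐ[μ] fun x => (h x : ℂ) * f x) (f : Lp ℂ 2 μ) (n : ℕ) :
    (X ^ n) f =ᵐ[μ] fun x => (h x : ℂ) ^ n * f x := by
  induction n with
  | zero => simp
  | succ n ih =>
    rw [pow_succ', mul_apply_eq_comp]
    filter_upwards [hX ((X ^ n) f), ih] with x h1 h2
    rw [h1, h2]; ring

theorem inner_pow_mul_operator {μ : Measure ℝ} {h : ℝ → ℝ} {X : Lp ℂ 2 μ →L[ℂ] Lp ℂ 2 μ}
    (hX : ∀ f, X f =ᵐ[μ] fun x => (h x : ℂ) * f x) {s : ℝ → ℝ} {f : Lp ℂ 2 μ}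
    (hf : f =ᵐ[μ] fun x => (s x : ℂ)) (n : ℕ) :
    inner ℂ f ((X ^ n) f) = ((∫ x, h x ^ n * s x ^ 2 ∂μ : ℝ) : ℂ) := by
  rw [L2.inner_def, ← integral_complex_ofReal]
  refine integral_congr_ae ?_
  filter_upwards [coeFn_pow_mul_operator hX f n, hf] with x h1 h2
  simp only [h1, h2, RCLike.inner_apply, Complex.conj_ofReal]
  push_cast
  ring

theorem inner_eq_ofReal_re_of_isSelfAdjoint {H : Type*} [NormedAddCommGroup H]
    [InnerProductSpace ℂ H] [CompleteSpace H] {T : H →L[ℂ] H} (hT : IsSelfAdjoint T) (v : H) :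
    inner ℂ v (T v) = (((inner ℂ v (T v)).re : ℝ) : ℂ) := by
  symm
  rw [← Complex.conj_eq_iff_re, inner_conj_symm]
  exact (ContinuousLinearMap.isSelfAdjoint_iff_isSymmetric.1 hT) v v

/-- A centered, compactly supported probability measure `ν` has a compactly supported measure `ρ`
with `M_ν(θ) = 1 + θ² M_ν(θ) M_ρ(θ)`, expressed through moments. -/
theorem exists_measure_moment_recursion_of_mean_zero (ν : Measure ℝ) [IsProbabilityMeasure ν]
    (R : ℝ) (hR : ν (Icc (-R) R)ᶜ = 0) (h0 : ∫ x, x ∂ν = 0) :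
    ∃ ρ : Measure ℝ, IsFiniteMeasure ρ ∧ (∃ R', ρ (Icc (-R') R')ᶜ = 0) ∧
      ∀ n : ℕ, ∫ x, x ^ (n + 2) ∂ν =
        ∑ j ∈ Finset.range (n + 1), (∫ x, x ^ j ∂ν) * ∫ x, x ^ (n - j) ∂ρ := by
  have hb : ∀ᵐ x ∂ν, |x| ≤ R := by
    have : Icc (-R) R ∈ ae ν := hR
    filter_upwards [this] with x hx using abs_le.2 hx
  obtain ⟨X, hXs, hX⟩ := exists_mul_operator ν (fun x => x) measurable_id R hb
  have h1L : MemLp (fun _ : ℝ => (1 : ℂ)) 2 ν := memLp_const 1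
  set e : Lp ℂ 2 ν := h1L.toLp with he
  have hes : e =ᵐ[ν] fun x => (((fun _ => 1 : ℝ → ℝ) x : ℝ) : ℂ) := by
    filter_upwards [h1L.coeFn_toLp] with x hx
    rw [he, hx]; simp
  have hm : ∀ n, inner ℂ e ((X ^ n) e) = ((∫ x, x ^ n ∂ν : ℝ) : ℂ) := fun n => by
    rw [inner_pow_mul_operator hX hes]; simp
  set v := X e with hv
  have hee : inner ℂ e e = (1 : ℂ) := by have := hm 0; simpa using this
  have hev : inner ℂ e v = (0 : ℂ) := by
    have := hm 1
    simp only [pow_one] at this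
    rw [hv, this, h0]; simp
  have hve : inner ℂ v e = (0 : ℂ) := by rw [← inner_conj_symm, hev, map_zero]
  -- As `⟪e, X e⟫ = 0`, this is the compression of `X` to the orthogonal complement of `e`, extended
  -- by `0`.
  set T := X - (InnerProductSpace.rankOne ℂ e v + InnerProductSpace.rankOne ℂ v e) with hT
  have hTs : IsSelfAdjoint T := hXs.sub (isSelfAdjoint_rankOne_add e v)
  have hTe : T e = 0 := by
    simp [hT, ← hv, InnerProductSpace.rankOne_apply, hve, hee, -inner_self_eq_norm_sq_to_K]
  obtain ⟨ρ, hρ, hρR, hρm⟩ := exists_measure_moments_eq T hTs v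
  refine ⟨ρ, hρ, ⟨_, hρR⟩, fun n => ?_⟩
  have key := inner_pow_add_two_eq_sum X T e v hee hev hTe
    (fun y => by
      have := (ContinuousLinearMap.isSelfAdjoint_iff_isSymmetric.1 hTs) e y
      simp only [ContinuousLinearMap.coe_coe] at this
      rw [← this, hTe, inner_zero_left])
    (fun y => by simp [hT, InnerProductSpace.rankOne_apply, add_assoc]) n
  have hr : ∀ j, inner ℂ v ((T ^ j) v) = ((∫ x, x ^ j ∂ρ : ℝ) : ℂ) := fun j => by
    rw [hρm, inner_eq_ofReal_re_of_isSelfAdjoint (hTs.pow j)]; simp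
  simp only [hm, hr] at key
  exact_mod_cast key

/-- Converse construction: a compactly supported finite measure `ρ` comes from a centered
probability measure `ν` with `M_ν(θ) = 1 + θ² M_ν(θ) M_ρ(θ)`, expressed through moments. -/
theorem exists_measure_moment_recursion (ρ : Measure ℝ) [IsFiniteMeasure ρ]
    (R : ℝ) (hR : ρ (Icc (-R) R)ᶜ = 0) :
    ∃ ν : Measure ℝ, IsProbabilityMeasure ν ∧ (∃ R', ν (Icc (-R') R')ᶜ = 0) ∧ ∫ x, x ∂ν = 0 ∧
      ∀ n : ℕ, ∫ x, x ^ (n + 2) ∂ν =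
        ∑ j ∈ Finset.range (n + 1), (∫ x, x ^ j ∂ν) * ∫ x, x ^ (n - j) ∂ρ := by
  -- The atom outside `[-R, R]` adds to `L²(ρ)` one orthogonal dimension, spanned by `e = u`. The
  -- vector `v = s` plays the role of the constant `1` in `L²(ρ)`, and the cutoff in `x * s x` makes
  -- `X` vanish on `e`.
  set μ := ρ + Measure.dirac (R + 1) with hμ
  set s := (Icc (-R) R).indicator (1 : ℝ → ℝ) with hs
  set u := ({R + 1} : Set ℝ).indicator (1 : ℝ → ℝ) with hu
  have hsm : Measurable s := measurable_one.indicator measurableSet_Icc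
  have hum : Measurable u := measurable_one.indicator (measurableSet_singleton _)
  have hsR : s (R + 1) = 0 := by simp [hs]
  have hρs : ∀ᵐ x ∂ρ, s x = 1 := by
    have : Icc (-R) R ∈ ae ρ := hR
    filter_upwards [this] with x hx
    simp [hs, hx.1, hx.2]
  have hρu : ∀ᵐ x ∂ρ, u x = 0 := by
    have : Icc (-R) R ∈ ae ρ := hR
    filter_upwards [this] with x hx
    have : x ≠ R + 1 := by have := hx.2; intro h; linarith
    simp [hu, this]
  have hsu : ∀ x, s x * u x = 0 := fun x => by
    by_cases hx : x = R + 1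
    · rw [hx, hsR, zero_mul]
    · simp [hu, hx]
  have hC : ∀ᵐ x ∂μ, |x * s x| ≤ |R| := by
    refine Eventually.of_forall fun x => ?_
    by_cases hx : x ∈ Icc (-R) R
    · simp only [hs, indicator_of_mem hx, Pi.one_apply, mul_one]
      exact (abs_le.2 hx).trans (le_abs_self R)
    · simp [hs, indicator_of_notMem hx]
  obtain ⟨X, hXs, hX⟩ := exists_mul_operator μ (fun x => x * s x) (by fun_prop) |R| hC
  have heL : MemLp (fun x => (u x : ℂ)) 2 μ := by
    refine MemLp.of_bound (by fun_prop) 1 (Eventually.of_forall fun x => ?_)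
    by_cases hx : x = R + 1 <;> simp [hu, hx]
  have hvL : MemLp (fun x => (s x : ℂ)) 2 μ := by
    refine MemLp.of_bound (by fun_prop) 1 (Eventually.of_forall fun x => ?_)
    by_cases hx : x ∈ Icc (-R) R
    · simp only [hs, indicator_of_mem hx]; simp
    · simp [hs, indicator_of_notMem hx]
  set e : Lp ℂ 2 μ := heL.toLp with he
  set v : Lp ℂ 2 μ := hvL.toLp with hv
  have hes : e =ᵐ[μ] fun x => (u x : ℂ) := heL.coeFn_toLp
  have hvs : v =ᵐ[μ] fun x => (s x : ℂ) := hvL.coeFn_toLp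
  have hXe : X e = 0 := by
    apply Lp.ext
    filter_upwards [hX e, hes, Lp.coeFn_zero ℂ 2 μ] with x h1 h2 h3
    rw [h1, h2, h3, Pi.zero_apply, ← Complex.ofReal_mul, mul_assoc, hsu]; simp
  have hee : inner ℂ e e = (1 : ℂ) := by
    have := inner_pow_mul_operator hX hes 0
    simp only [pow_zero, one_mul, one_apply_eq_self] at this
    rw [this, hμ, integral_add_measure, integral_dirac]
    · rw [integral_congr_ae (g := fun _ => (0 : ℝ))
        (by filter_upwards [hρu] with x hx; rw [hx]; simp)]
      simp [hu]
    · refine Integrable.congr (integrable_zero ℝ ℝ ρ) ?_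
      filter_upwards [hρu] with x hx; rw [hx]; simp
    · exact integrable_dirac (by simp)
  have hev : inner ℂ e v = (0 : ℂ) := by
    rw [L2.inner_def]
    refine integral_eq_zero_of_ae ?_
    filter_upwards [hes, hvs] with x h1 h2
    simp only [h1, h2, RCLike.inner_apply, Complex.conj_ofReal]
    rw [← Complex.ofReal_mul, hsu]; simp
  have hve : inner ℂ v e = (0 : ℂ) := by rw [← inner_conj_symm, hev, map_zero]
  set A := X + (InnerProductSpace.rankOne ℂ e v + InnerProductSpace.rankOne ℂ v e) with hA
  have hAs : IsSelfAdjoint A := hXs.add (isSelfAdjoint_rankOne_add e v)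
  have hAe : A e = v := by
    simp [hA, hXe, InnerProductSpace.rankOne_apply, hve, hee, -inner_self_eq_norm_sq_to_K]
  obtain ⟨ν, hν, hνR, hνm⟩ := exists_measure_moments_eq A hAs e
  have hνc : ∀ n, inner ℂ e ((A ^ n) e) = ((∫ x, x ^ n ∂ν : ℝ) : ℂ) := fun n => by
    rw [hνm, inner_eq_ofReal_re_of_isSelfAdjoint (hAs.pow n)]; simp
  have hr : ∀ n, inner ℂ v ((X ^ n) v) = ((∫ x, x ^ n ∂ρ : ℝ) : ℂ) := fun n => by
    rw [inner_pow_mul_operator hX hvs, hμ, integral_add_measure, integral_dirac]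
    · rw [hsR, integral_congr_ae (g := fun x => x ^ n)
        (by filter_upwards [hρs] with x hx; rw [hx]; simp)]
      simp
    · refine Integrable.of_bound (C := |R| ^ n) (by fun_prop) ?_
      have : Icc (-R) R ∈ ae ρ := hR
      filter_upwards [this, hρs] with x hx hx'
      rw [hx']
      simp only [mul_one, one_pow, norm_pow, Real.norm_eq_abs]
      exact pow_le_pow_left₀ (abs_nonneg _) ((abs_le.2 hx).trans (le_abs_self R)) n
    · exact integrable_dirac enorm_lt_top
  have hprob : IsProbabilityMeasure ν := by
    have h := hνm 0
    simp only [pow_zero, one_apply_eq_self, hee, integral_const, smul_eq_mul, mul_one,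
      Complex.one_re, Measure.real] at h
    exact ⟨(ENNReal.toReal_eq_one_iff _).1 h⟩
  refine ⟨ν, hprob, ⟨_, hνR⟩, ?_, fun n => ?_⟩
  · have h := hνm 1
    simpa [hAe, hev] using h
  · have key := inner_pow_add_two_eq_sum A X e v hee hev hXe
      (fun y => by
        have := (ContinuousLinearMap.isSelfAdjoint_iff_isSymmetric.1 hXs) e y
        simp only [ContinuousLinearMap.coe_coe] at this
        rw [← this, hXe, inner_zero_left])
      (fun y => by simp [hA, InnerProductSpace.rankOne_apply, add_assoc]) n
    simp only [hνc, hr] at key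
    exact_mod_cast key

/-! ### Lagrange inversion by formal residues -/

section Lagrange

theorem iteratedDeriv_succ_id_mul {F : ℝ → ℝ} (hF : AnalyticAt ℝ F 0) (n : ℕ) :
    iteratedDeriv (n + 1) (fun x => x * F x) 0 = (n + 1) * iteratedDeriv n F 0 := by
  have h := iteratedDeriv_fun_mul (n := n + 1) (f := fun x : ℝ => x) (g := F) (x := 0)
    (by fun_prop) hF.contDiffAt
  rw [h, Finset.sum_eq_single 1]
  · simp
  · intro i _ hi
    rcases i with _ | _ | i
    · simp
    · exact absurd rfl hi
    · have : iteratedDeriv (i + 2) (fun x : ℝ => x) 0 = 0 := by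
        rw [iteratedDeriv_succ', deriv_id'', iteratedDeriv_const]; simp
      simp [this]
  · simp

variable {W : ℝ → ℝ}

theorem hasDerivAt_div_self {x : ℝ} (hW : DifferentiableAt ℝ W x) (h : W x ≠ 0) :
    HasDerivAt (fun m => m / W m) ((W x - x * deriv W x) / W x ^ 2) x := by
  have := (hasDerivAt_id' x).fun_div hW.hasDerivAt h
  rwa [one_mul] at this

/-- The coefficient of `m⁻¹` in the derivative of a negative power of `m / W m` vanishes. -/
theorem iteratedDeriv_pow_sub_eq_zero (hW : AnalyticAt ℝ W 0) (n : ℕ) :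
    iteratedDeriv (n + 1) (fun m => W m ^ (n + 1) - m * (W m ^ n * deriv W m)) 0 = 0 := by
  have hid : AnalyticAt ℝ (fun m : ℝ => m) 0 := analyticAt_id
  have h1 : AnalyticAt ℝ (fun m => W m ^ n * deriv W m) 0 := (hW.fun_pow n).mul hW.deriv
  have h2 : deriv (fun m => W m ^ (n + 1)) =ᶠ[𝓝 0] fun m => (n + 1) • (W m ^ n * deriv W m) := by
    filter_upwards [hW.eventually_analyticAt] with m hm
    rw [deriv_fun_pow hm.differentiableAt]
    simp [mul_assoc]
  rw [iteratedDeriv_fun_sub (hW.fun_pow _).contDiffAt (hid.fun_mul h1).contDiffAt,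
    iteratedDeriv_succ_id_mul h1, iteratedDeriv_succ', h2.iteratedDeriv_eq]
  simp only [nsmul_eq_mul]
  rw [iteratedDeriv_const_mul_field]
  simp

/-- Change of variables `θ = m / W m` in a residue. -/
theorem iteratedDeriv_change_of_variables (hW : AnalyticAt ℝ W 0) (hW0 : W 0 ≠ 0) (n : ℕ) :
    ∀ φ : ℝ → ℝ, AnalyticAt ℝ φ 0 →
      iteratedDeriv n (fun m => W m ^ (n + 1) * deriv (fun m => m / W m) m * φ (m / W m)) 0
        = iteratedDeriv n φ 0 := by
  have hg : AnalyticAt ℝ (fun m => m / W m) 0 := analyticAt_id.fun_div hW hW0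
  have hWne : ∀ᶠ m in 𝓝 (0 : ℝ), W m ≠ 0 := hW.continuousAt.eventually_ne hW0
  have hg' : ∀ᶠ m in 𝓝 (0 : ℝ),
      deriv (fun m => m / W m) m = (W m - m * deriv W m) / W m ^ 2 := by
    filter_upwards [hW.eventually_analyticAt, hWne] with m h1 h2
    exact (hasDerivAt_div_self h1.differentiableAt h2).deriv
  induction n with
  | zero =>
    intro φ _
    simp only [iteratedDeriv_zero, hg'.self_of_nhds]
    field_simp
    simp [pow_two]
  | succ n ih =>
    intro φ hφ
    obtain ⟨p, hp⟩ := hφ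
    have hid : AnalyticAt ℝ (fun m : ℝ => m) 0 := analyticAt_id
    have hφ1 : AnalyticAt ℝ (dslope φ 0) 0 := hp.has_fpower_series_dslope_fslope.analyticAt
    have hd : ∀ θ, φ θ = φ 0 + θ * dslope φ 0 θ := fun θ => by
      have := sub_smul_dslope φ 0 θ
      simp only [sub_zero, smul_eq_mul] at this
      linarith
    have hcomp : AnalyticAt ℝ (fun m => dslope φ 0 (m / W m)) 0 :=
      AnalyticAt.fun_comp (by simpa using hφ1) hg
    have h1 : AnalyticAt ℝ (fun m => W m ^ (n + 1) - m * (W m ^ n * deriv W m)) 0 :=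
      (hW.fun_pow _).fun_sub (analyticAt_id.fun_mul ((hW.fun_pow n).fun_mul hW.deriv))
    have h2 : AnalyticAt ℝ
        (fun m => W m ^ (n + 1) * deriv (fun m => m / W m) m * dslope φ 0 (m / W m)) 0 :=
      ((hW.fun_pow _).fun_mul hg.deriv).fun_mul hcomp
    -- Split `φ θ = φ 0 + θ * dslope φ 0 θ`. The constant part contributes nothing, by the vanishing
    -- residue; in the other part the factor `m / W m` lowers the power of `W` by one, and the
    -- induction hypothesis applies.
    have e1 : (fun m => W m ^ (n + 1 + 1) * deriv (fun m => m / W m) m * φ (m / W m)) =ᶠ[𝓝 0]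
        fun m => φ 0 * (W m ^ (n + 1) - m * (W m ^ n * deriv W m)) +
          m * (W m ^ (n + 1) * deriv (fun m => m / W m) m * dslope φ 0 (m / W m)) := by
      filter_upwards [hg', hWne] with m h3 h4
      rw [h3, hd (m / W m)]
      field_simp
      ring
    have e2 : iteratedDeriv (n + 1) φ 0 = (n + 1) * iteratedDeriv n (dslope φ 0) 0 := by
      rw [← iteratedDeriv_succ_id_mul hφ1]
      have : φ = fun θ => φ 0 + θ * dslope φ 0 θ := funext hd
      conv_lhs => rw [this]
      rw [iteratedDeriv_const_add n.succ_pos]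
    rw [e1.iteratedDeriv_eq, iteratedDeriv_fun_add (analyticAt_const.fun_mul h1).contDiffAt
        (hid.fun_mul h2).contDiffAt,
      iteratedDeriv_const_mul_field, iteratedDeriv_pow_sub_eq_zero hW, iteratedDeriv_succ_id_mul h2,
      ih _ hφ1, e2]
    simp

/-- **Lagrange inversion** for a local inverse of `m ↦ m / W m`. -/
theorem iteratedDeriv_succ_of_leftInverse {κ : ℝ → ℝ} (hW : AnalyticAt ℝ W 0) (hW0 : W 0 ≠ 0)
    (hκ : AnalyticAt ℝ κ 0) (h : ∀ᶠ m in 𝓝 0, κ (m / W m) = m) (n : ℕ) :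
    iteratedDeriv (n + 1) κ 0 = iteratedDeriv n (fun m => W m ^ (n + 1)) 0 := by
  have hg : AnalyticAt ℝ (fun m => m / W m) 0 := analyticAt_id.fun_div hW hW0
  -- Take `φ = κ'`: by the chain rule `κ'(m / W m) * (m / W m)' = 1`, which leaves only the power of
  -- `W`.
  rw [iteratedDeriv_succ', ← iteratedDeriv_change_of_variables hW hW0 n _ hκ.deriv]
  refine Filter.EventuallyEq.iteratedDeriv_eq _ ?_
  have hκ' : ∀ᶠ m in 𝓝 (0 : ℝ), AnalyticAt ℝ κ (m / W m) := by
    have := hg.continuousAt.tendsto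
    simp only [zero_div] at this
    exact this.eventually hκ.eventually_analyticAt
  filter_upwards [h.eventually_nhds, hκ', hg.eventually_analyticAt] with m h1 h2 h3
  have h4 : HasDerivAt (fun m => κ (m / W m)) (deriv κ (m / W m) * deriv (fun m => m / W m) m) m :=
    h2.differentiableAt.hasDerivAt.comp m h3.differentiableAt.hasDerivAt
  have h5 : HasDerivAt (fun m => κ (m / W m)) 1 m :=
    (hasDerivAt_id m).congr_of_eventuallyEq h1
  rw [mul_assoc, mul_comm (deriv _ m), h4.unique h5, mul_one]

/-- The local inverse of `m ↦ m / W m` is analytic. -/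
theorem exists_analyticAt_localInverse (hW : AnalyticAt ℝ W 0) (hW0 : W 0 ≠ 0) :
    ∃ κ : ℝ → ℝ, AnalyticAt ℝ κ 0 ∧ κ 0 = 0 ∧ (∀ᶠ m in 𝓝 0, κ (m / W m) = m) ∧
      ∀ᶠ θ in 𝓝 0, κ θ / W (κ θ) = θ := by
  have hg : AnalyticAt ℝ (fun m => m / W m) 0 := analyticAt_id.fun_div hW hW0
  have hd : deriv (fun m => m / W m) 0 ≠ 0 := by
    rw [(hasDerivAt_div_self hW.differentiableAt hW0).deriv]
    simp [hW0]
  have hs := hg.hasStrictDerivAt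
  refine ⟨hs.localInverse _ _ _ hd, ?_, ?_, ?_, ?_⟩
  · simpa using hg.analyticAt_localInverse hd
  · have := (hs.hasStrictFDerivAt_equiv hd).localInverse_apply_image
    simpa [HasStrictDerivAt.localInverse] using this
  · exact (hs.hasStrictFDerivAt_equiv hd).eventually_left_inverse
  · have := (hs.hasStrictFDerivAt_equiv hd).eventually_right_inverse
    simpa [HasStrictDerivAt.localInverse] using this

end Lagrange

/-! ### Power series and moment generating functions -/

section PowerSeries

theorem exists_coeff_bound {F : ℝ → ℝ} {p : FormalMultilinearSeries ℝ ℝ ℝ}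
    (hp : HasFPowerSeriesAt F p 0) : ∃ C R : ℝ, 0 ≤ C ∧ 0 ≤ R ∧ ∀ n, |p.coeff n| ≤ C * R ^ n := by
  obtain ⟨r, hr0, hr⟩ := ENNReal.lt_iff_exists_nnreal_btwn.1 hp.radius_pos
  have hr0' : (0 : ℝ) < r := by exact_mod_cast hr0
  obtain ⟨C, hC, h⟩ := p.norm_mul_pow_le_of_lt_radius hr
  refine ⟨C, (r : ℝ)⁻¹, hC.le, by positivity, fun n => ?_⟩
  rw [← Real.norm_eq_abs, ← p.norm_apply_eq_norm_coef, inv_pow, ← div_eq_mul_inv,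
    le_div_iff₀ (by positivity)]
  exact h n

theorem eventuallyEq_of_iteratedDeriv_eq {f g : ℝ → ℝ} (hf : AnalyticAt ℝ f 0)
    (hg : AnalyticAt ℝ g 0) (h : ∀ n, iteratedDeriv n f 0 = iteratedDeriv n g 0) :
    f =ᶠ[𝓝 0] g := by
  have h1 := hf.hasFPowerSeriesAt
  have h2 := hg.hasFPowerSeriesAt
  simp only [h] at h1
  filter_upwards [hasFPowerSeriesAt_iff'.1 h1, hasFPowerSeriesAt_iff'.1 h2] with z hz1 hz2
  exact hz1.unique hz2

end PowerSeries

section Moments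

variable {ν : Measure ℝ}

/-- Markov's inequality for the even moments gives `ν {|x| ≥ R + 1} ≤ C * (R / (R + 1)) ^ (2n)`,
which tends to `0`. -/
theorem measure_compl_Icc_eq_zero_of_moment_bound [IsFiniteMeasure ν] {C R : ℝ} (hR : 0 ≤ R)
    (hint : ∀ n : ℕ, Integrable (fun x => x ^ n) ν) (h : ∀ n : ℕ, |∫ x, x ^ n ∂ν| ≤ C * R ^ n) :
    ν (Icc (-(R + 1)) (R + 1))ᶜ = 0 := by
  set s := {x : ℝ | R + 1 ≤ |x|} with hs
  have hsub : (Icc (-(R + 1)) (R + 1))ᶜ ⊆ s := fun x hx => by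
    by_contra h'
    exact hx (abs_le.1 (not_le.1 h').le)
  refine measure_mono_null hsub ?_
  have key : ∀ n : ℕ, ν.real s ≤ C * ((R / (R + 1)) ^ 2) ^ n := fun n => by
    have h1 := mul_meas_ge_le_integral_of_nonneg (μ := ν) (f := fun x => x ^ (2 * n))
      (Eventually.of_forall fun x => (even_two_mul n).pow_nonneg x) (hint _) ((R + 1) ^ (2 * n))
    have h2 : s ⊆ {x | (R + 1) ^ (2 * n) ≤ x ^ (2 * n)} := fun x hx => by
      have : (R + 1) ^ (2 * n) ≤ |x| ^ (2 * n) := pow_le_pow_left₀ (by positivity) hx _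
      rwa [(even_two_mul n).pow_abs] at this
    have h3 : (R + 1) ^ (2 * n) * ν.real s ≤ C * R ^ (2 * n) :=
      (mul_le_mul_of_nonneg_left (measureReal_mono h2) (by positivity)).trans
        (h1.trans ((le_abs_self _).trans (h _)))
    rw [← pow_mul, div_pow, ← mul_div_assoc, le_div_iff₀ (by positivity), mul_comm]
    exact h3
  have hlim : Tendsto (fun n : ℕ => C * ((R / (R + 1)) ^ 2) ^ n) atTop (𝓝 (C * 0)) :=
    (tendsto_pow_atTop_nhds_zero_of_lt_one (by positivity)
      (pow_lt_one₀ (by positivity) ((div_lt_one (by positivity)).2 (by linarith))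
        (by norm_num))).const_mul C
  rw [mul_zero] at hlim
  have h0 : ν.real s = 0 := le_antisymm (ge_of_tendsto' hlim key) measureReal_nonneg
  simpa [Measure.real, ENNReal.toReal_eq_zero_iff, measure_ne_top] using h0

theorem exists_pos_of_measure_compl_Icc (h : ∃ R, ν (Icc (-R) R)ᶜ = 0) :
    ∃ R, 0 < R ∧ ∀ᵐ x ∂ν, |x| ≤ R := by
  obtain ⟨R, hR⟩ := h
  have : Icc (-R) R ∈ ae ν := hR
  refine ⟨|R| + 1, by positivity, ?_⟩
  filter_upwards [this] with x hx
  have := abs_le.2 hx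
  have := le_abs_self R
  linarith

theorem integrable_pow_of_ae_abs_le [IsFiniteMeasure ν] {R : ℝ} (h : ∀ᵐ x ∂ν, |x| ≤ R) (n : ℕ) :
    Integrable (fun x => x ^ n) ν := by
  refine Integrable.of_bound (C := R ^ n) (by fun_prop) ?_
  filter_upwards [h] with x hx
  rw [norm_pow]
  exact pow_le_pow_left₀ (abs_nonneg _) hx n

theorem hasSum_moments [IsFiniteMeasure ν] {R θ : ℝ} (hR : ∀ᵐ x ∂ν, |x| ≤ R) (hR0 : 0 < R)
    (hθ : |θ| * R < 1) : HasSum (fun n : ℕ => θ ^ n * ∫ x, x ^ n ∂ν) (M ν θ) := by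
  have hnn : 0 ≤ |θ| * R := by positivity
  have := hasSum_integral_of_dominated_convergence (μ := ν) (F := fun (n : ℕ) x => θ ^ n * x ^ n)
    (f := fun x => 1 / (1 - θ * x)) (fun n _ => (|θ| * R) ^ n) (fun n => by fun_prop)
    (fun n => by
      filter_upwards [hR] with x hx
      rw [← mul_pow, norm_pow, norm_mul]
      exact pow_le_pow_left₀ (by positivity) (mul_le_mul_of_nonneg_left hx (abs_nonneg _)) n)
    (Eventually.of_forall fun _ => summable_geometric_of_lt_one hnn hθ)
    (integrable_const _)
    (by
      filter_upwards [hR] with x hx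
      simp only [← mul_pow, one_div]
      refine hasSum_geometric_of_norm_lt_one ?_
      rw [norm_mul]
      exact (mul_le_mul_of_nonneg_left hx (abs_nonneg _)).trans_lt hθ)
  simp only [integral_const_mul] at this
  exact this

theorem eventually_abs_mul_lt_one (R : ℝ) : ∀ᶠ θ in 𝓝 (0 : ℝ), |θ| * R < 1 := by
  have : Tendsto (fun θ : ℝ => |θ| * R) (𝓝 0) (𝓝 (|0| * R)) :=
    Continuous.tendsto (by fun_prop) 0
  exact this.eventually (gt_mem_nhds (by simp))

theorem hasFPowerSeriesAt_M [IsFiniteMeasure ν] (h : ∃ R, ν (Icc (-R) R)ᶜ = 0) :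
    HasFPowerSeriesAt (M ν) (FormalMultilinearSeries.ofScalars ℝ fun n => ∫ x, x ^ n ∂ν) 0 := by
  obtain ⟨R, hR0, hR⟩ := exists_pos_of_measure_compl_Icc h
  rw [hasFPowerSeriesAt_iff']
  filter_upwards [eventually_abs_mul_lt_one R] with θ hθ
  simpa [FormalMultilinearSeries.coeff_ofScalars] using hasSum_moments hR hR0 hθ

theorem iteratedDeriv_M [IsFiniteMeasure ν] (h : ∃ R, ν (Icc (-R) R)ᶜ = 0) (n : ℕ) :
    iteratedDeriv n (M ν) 0 = n.factorial * ∫ x, x ^ n ∂ν := by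
  have h1 := hasFPowerSeriesAt_M h
  have h2 := h1.analyticAt.hasFPowerSeriesAt
  have h3 := congrArg (fun p => p.coeff n) (h2.eq_formalMultilinearSeries h1)
  simp only [FormalMultilinearSeries.coeff_ofScalars] at h3
  rw [div_eq_iff (by positivity)] at h3
  rw [h3, mul_comm]

/-- The recursion is a Cauchy product of the two moment series; the moments of order `0` and `1`
supply the `1` and the missing linear term. -/
theorem M_eq_of_moment_recursion {ρ : Measure ℝ} [IsProbabilityMeasure ν] [IsFiniteMeasure ρ]
    (hν : ∃ R, ν (Icc (-R) R)ᶜ = 0) (hρ : ∃ R, ρ (Icc (-R) R)ᶜ = 0) (h0 : ∫ x, x ∂ν = 0)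
    (h : ∀ n : ℕ, ∫ x, x ^ (n + 2) ∂ν =
        ∑ j ∈ Finset.range (n + 1), (∫ x, x ^ j ∂ν) * ∫ x, x ^ (n - j) ∂ρ) :
    ∀ᶠ θ in 𝓝 0, M ν θ = 1 + θ ^ 2 * (M ν θ * M ρ θ) := by
  obtain ⟨R, hR0, hR⟩ := exists_pos_of_measure_compl_Icc hν
  obtain ⟨S, hS0, hS⟩ := exists_pos_of_measure_compl_Icc hρ
  filter_upwards [eventually_abs_mul_lt_one R, eventually_abs_mul_lt_one S] with θ hθR hθS
  have h1 := hasSum_moments hR hR0 hθR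
  have h2 := hasSum_moments hS hS0 hθS
  have hprod := tsum_mul_tsum_eq_tsum_sum_range_of_summable_norm h1.summable.norm h2.summable.norm
  rw [h1.tsum_eq, h2.tsum_eq] at hprod
  have hs : Summable fun n => θ ^ (n + 2) * ∫ x, x ^ (n + 2) ∂ν :=
    (summable_nat_add_iff 2).2 h1.summable
  rw [hprod, ← tsum_mul_left, ← h1.tsum_eq, ← h1.summable.sum_add_tsum_nat_add 2]
  congr 1
  · simp [Finset.sum_range_succ, h0]
  · refine tsum_congr fun n => ?_
    rw [h n, Finset.mul_sum, Finset.mul_sum]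
    refine Finset.sum_congr rfl fun j hj => ?_
    have : n = j + (n - j) := by have := Finset.mem_range.1 hj; omega
    have e : θ ^ (n + 2) = θ ^ 2 * (θ ^ j * θ ^ (n - j)) := by
      rw [← pow_add, ← this]; ring
    rw [e]
    ring

end Moments

/-! ### Compact support from one-sided analytic continuation -/

section OneSided

variable {ν : Measure ℝ} {b : ℝ}

theorem eventually_pos_and_mul_le (b : ℝ) :
    ∀ᶠ θ in 𝓝[>] (0 : ℝ), 0 < θ ∧ θ * b ≤ 1 / 2 := by
  have : Tendsto (fun θ : ℝ => θ * b) (𝓝[>] 0) (𝓝 (0 * b)) :=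
    (Continuous.tendsto (by fun_prop) 0).mono_left nhdsWithin_le_nhds
  filter_upwards [self_mem_nhdsWithin,
    this.eventually (ge_mem_nhds (show 0 * b < 1 / 2 by norm_num))] with θ h1 h2 using ⟨h1, h2⟩

theorem half_le_one_sub_mul {θ x : ℝ} (hx : x ≤ b) (h0 : 0 < θ) (h : θ * b ≤ 1 / 2) :
    1 / 2 ≤ 1 - θ * x := by
  nlinarith

theorem norm_pow_div_le {θ x : ℝ} (n : ℕ) (h : 1 / 2 ≤ 1 - θ * x) :
    ‖x ^ n / (1 - θ * x)‖ ≤ 2 * ‖x ^ n‖ := by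
  rw [norm_div, Real.norm_of_nonneg (by linarith : 0 ≤ 1 - θ * x), div_le_iff₀ (by linarith)]
  have := norm_nonneg (x ^ n)
  nlinarith

theorem integrable_pow_div (hν : ∀ᵐ x ∂ν, x ≤ b) {n : ℕ}
    (hint : Integrable (fun x => x ^ n) ν) {θ : ℝ} (h0 : 0 < θ) (h : θ * b ≤ 1 / 2) :
    Integrable (fun x => x ^ n / (1 - θ * x)) ν := by
  refine (hint.norm.const_mul 2).mono' (Measurable.aestronglyMeasurable (by fun_prop)) ?_
  filter_upwards [hν] with x hx
  exact norm_pow_div_le n (half_le_one_sub_mul hx h0 h)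

theorem integral_pow_eq_of_eventually (hν : ∀ᵐ x ∂ν, x ≤ b) {n : ℕ}
    (hint : Integrable (fun x => x ^ n) ν) {G : ℝ → ℝ} (hG : ContinuousAt G 0)
    (h : ∀ᶠ θ in 𝓝[>] 0, ∫ x, x ^ n / (1 - θ * x) ∂ν = G θ) : ∫ x, x ^ n ∂ν = G 0 := by
  have h1 : Tendsto (fun θ => ∫ x, x ^ n / (1 - θ * x) ∂ν) (𝓝[>] 0) (𝓝 (∫ x, x ^ n ∂ν)) := by
    refine tendsto_integral_filter_of_dominated_convergence (fun x => 2 * ‖x ^ n‖)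
      (Eventually.of_forall fun θ => Measurable.aestronglyMeasurable (by fun_prop)) ?_
      (hint.norm.const_mul 2) (Eventually.of_forall fun x => ?_)
    · filter_upwards [eventually_pos_and_mul_le b] with θ hθ
      filter_upwards [hν] with x hx
      exact norm_pow_div_le n (half_le_one_sub_mul hx hθ.1 hθ.2)
    · have : ContinuousAt (fun θ : ℝ => x ^ n / (1 - θ * x)) 0 :=
        ContinuousAt.div (by fun_prop) (by fun_prop) (by simp)
      simpa using this.tendsto.mono_left nhdsWithin_le_nhds
  exact tendsto_nhds_unique (h1.congr' h) (hG.tendsto.mono_left nhdsWithin_le_nhds)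

/-- Raising the power of `x` is taking the difference quotient at `0` of `θ ↦ ∫ x ^ n / (1 - θ *
x)`; on the analytic side this is `dslope`. -/
theorem integral_pow_succ_div (hν : ∀ᵐ x ∂ν, x ≤ b) {n : ℕ}
    (hint : Integrable (fun x => x ^ n) ν) {θ : ℝ} (h0 : 0 < θ) (h : θ * b ≤ 1 / 2) :
    Integrable (fun x => x ^ (n + 1) / (1 - θ * x)) ν ∧
      ∫ x, x ^ (n + 1) / (1 - θ * x) ∂ν =
        (∫ x, x ^ n / (1 - θ * x) ∂ν - ∫ x, x ^ n ∂ν) / θ := by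
  have h1 := integrable_pow_div hν hint h0 h
  have e : (fun x => x ^ (n + 1) / (1 - θ * x)) =ᵐ[ν]
      fun x => (x ^ n / (1 - θ * x) - x ^ n) / θ := by
    filter_upwards [hν] with x hx
    have := half_le_one_sub_mul hx h0 h
    have h3 : 1 - θ * x ≠ 0 := by linarith
    field_simp
    ring
  refine ⟨(h1.sub hint).div_const θ |>.congr e.symm, ?_⟩
  rw [integral_congr_ae e, integral_div, integral_sub h1 hint]

/-- A Fatou-type converse to dominated convergence. The sign `(-1) ^ n` makes the integrand
nonnegative on the unbounded half-line `x ≤ 0`; on `[0, b]` it is at least `-2 * b ^ n` and its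
modulus at most `2 * b ^ n`, whence the correction `4 * b ^ n`. -/
theorem integrable_pow_of_bounded [IsFiniteMeasure ν] (hb : 0 ≤ b) (hν : ∀ᵐ x ∂ν, x ≤ b) {n : ℕ} {K : ℝ}
    (hint : ∀ᶠ θ in 𝓝[>] (0 : ℝ), Integrable (fun x => x ^ n / (1 - θ * x)) ν)
    (h : ∀ᶠ θ in 𝓝[>] (0 : ℝ), |∫ x, x ^ n / (1 - θ * x) ∂ν| ≤ K) :
    Integrable (fun x => x ^ n) ν := by
  have hcov : AECover ν atTop fun N : ℕ => Icc (-(N : ℝ)) N :=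
    aecover_Icc (tendsto_neg_atTop_atBot.comp tendsto_natCast_atTop_atTop)
      tendsto_natCast_atTop_atTop
  refine hcov.integrable_of_integral_norm_bounded (2 * (K + 4 * b ^ n * ν.real univ))
    (fun N => ?_) (Eventually.of_forall fun N => ?_)
  · exact (continuous_pow n).continuousOn.integrableOn_compact isCompact_Icc
  · obtain ⟨θ, hθi, hθK, ⟨hθ0, hθb⟩, -, hθN⟩ :=
      (hint.and (h.and ((eventually_pos_and_mul_le b).and (eventually_pos_and_mul_le N)))).exists
    have hdom : Integrable
        (fun x => 2 * ((-1) ^ n * (x ^ n / (1 - θ * x)) + 4 * b ^ n)) ν :=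
      ((hθi.const_mul _).add (integrable_const _)).const_mul 2
    have hle : ∀ x, x ≤ b →
        |x| ^ n / (1 - θ * x) ≤ (-1) ^ n * (x ^ n / (1 - θ * x)) + 4 * b ^ n := fun x hx => by
      have h2 := half_le_one_sub_mul hx hθ0 hθb
      rcases le_total x 0 with hx0 | hx0
      · rw [abs_of_nonpos hx0, neg_pow, mul_div_assoc]
        have : 0 ≤ b ^ n := by positivity
        linarith
      · have h3 := norm_pow_div_le n h2
        have h4 : x ^ n ≤ b ^ n := pow_le_pow_left₀ hx0 hx n
        have h5 : |(-1) ^ n * (x ^ n / (1 - θ * x))| ≤ 2 * x ^ n := by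
          rw [abs_mul, abs_neg_one_pow, one_mul]
          rwa [Real.norm_eq_abs, Real.norm_of_nonneg (by positivity)] at h3
        have h6 : x ^ n / (1 - θ * x) ≤ 2 * x ^ n := by
          rw [Real.norm_of_nonneg (by positivity : 0 ≤ x ^ n)] at h3
          exact (le_abs_self _).trans h3
        rw [abs_of_nonneg hx0]
        have := (abs_le.1 h5).1
        linarith
    have hnn : ∀ x, x ≤ b → 0 ≤ 2 * ((-1) ^ n * (x ^ n / (1 - θ * x)) + 4 * b ^ n) :=
      fun x hx => by
        have h2 := half_le_one_sub_mul hx hθ0 hθb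
        have : 0 ≤ |x| ^ n / (1 - θ * x) := div_nonneg (by positivity) (by linarith)
        linarith [hle x hx]
    calc ∫ x in Icc (-(N : ℝ)) N, ‖x ^ n‖ ∂ν
        ≤ ∫ x in Icc (-(N : ℝ)) N, 2 * ((-1) ^ n * (x ^ n / (1 - θ * x)) + 4 * b ^ n) ∂ν := by
          refine setIntegral_mono_on_ae
            ((continuous_pow n).norm.continuousOn.integrableOn_compact isCompact_Icc)
            hdom.integrableOn measurableSet_Icc ?_
          filter_upwards [hν] with x hx hxN
          have h2 := half_le_one_sub_mul hx hθ0 hθb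
          refine le_trans ?_ (mul_le_mul_of_nonneg_left (hle x hx) zero_le_two)
          rw [norm_pow, Real.norm_eq_abs, ← mul_div_assoc, le_div_iff₀ (by linarith), mul_comm]
          refine mul_le_mul_of_nonneg_right ?_ (by positivity)
          nlinarith [hxN.1]
      _ ≤ ∫ x, 2 * ((-1) ^ n * (x ^ n / (1 - θ * x)) + 4 * b ^ n) ∂ν :=
          setIntegral_le_integral hdom (by filter_upwards [hν] with x hx using hnn x hx)
      _ = 2 * ((-1) ^ n * ∫ x, x ^ n / (1 - θ * x) ∂ν + 4 * b ^ n * ν.real univ) := by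
          rw [integral_const_mul, integral_add (hθi.const_mul _) (integrable_const _),
            integral_const_mul, integral_const, smul_eq_mul, mul_comm (ν.real univ)]
      _ ≤ 2 * (K + 4 * b ^ n * ν.real univ) := by
          have : (-1) ^ n * ∫ x, x ^ n / (1 - θ * x) ∂ν ≤ K := by
            refine (le_abs_self _).trans ?_
            rwa [abs_mul, abs_neg_one_pow, one_mul]
          linarith

/-- If the Cauchy-Stieltjes transform of a measure with support bounded from above continues
analytically through `0`, then the measure has compact support. -/
theorem exists_compact_support_of_analytic_right [IsFiniteMeasure ν] (hb : 0 ≤ b) (hν : ∀ᵐ x ∂ν, x ≤ b) {F : ℝ → ℝ}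
    (hF : AnalyticAt ℝ F 0) (h : ∀ᶠ θ in 𝓝[>] 0, M ν θ = F θ) : ∃ R, ν (Icc (-R) R)ᶜ = 0 := by
  obtain ⟨p, hp⟩ := hF
  -- The Taylor series of `G n` is that of `F` shifted by `n`, so `G n 0` is the `n`-th coefficient
  -- of `F`. Inductively the `n`-th moment exists and equals it.
  set G : ℕ → ℝ → ℝ := fun n => (Function.swap dslope 0)^[n] F with hGdef
  have hG : ∀ n, HasFPowerSeriesAt (G n) (FormalMultilinearSeries.fslope^[n] p) 0 := fun n =>
    hp.has_fpower_series_iterate_dslope_fslope n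
  have key : ∀ n : ℕ, Integrable (fun x => x ^ n) ν ∧
      ∀ᶠ θ in 𝓝[>] 0, ∫ x, x ^ n / (1 - θ * x) ∂ν = G n θ := by
    intro n
    induction n with
    | zero =>
      refine ⟨by simp, ?_⟩
      filter_upwards [h] with θ hθ
      simpa [M, hGdef] using hθ
    | succ n ih =>
      obtain ⟨h1, h2⟩ := ih
      have h3 := integral_pow_eq_of_eventually hν h1 (hG n).continuousAt h2
      have h4 : ∀ᶠ θ in 𝓝[>] 0, ∫ x, x ^ (n + 1) / (1 - θ * x) ∂ν = G (n + 1) θ := by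
        filter_upwards [eventually_pos_and_mul_le b, h2] with θ hθ h2
        have hGs : G (n + 1) θ = dslope (G n) 0 θ := by
          simp only [hGdef, Function.iterate_succ_apply', Function.swap]
        rw [(integral_pow_succ_div hν h1 hθ.1 hθ.2).2, h2, h3, hGs,
          dslope_of_ne _ hθ.1.ne', slope_def_field, sub_zero]
      refine ⟨integrable_pow_of_bounded hb hν (K := |G (n + 1) 0| + 1) ?_ ?_, h4⟩
      · filter_upwards [eventually_pos_and_mul_le b] with θ hθ
        exact (integral_pow_succ_div hν h1 hθ.1 hθ.2).1
      · have hc : ∀ᶠ θ in 𝓝[>] 0, |G (n + 1) θ| < |G (n + 1) 0| + 1 :=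
          ((hG (n + 1)).continuousAt.abs.tendsto.mono_left nhdsWithin_le_nhds).eventually
            (gt_mem_nhds (lt_add_one _))
        filter_upwards [hc, h4] with θ h5 h6
        rw [h6]
        exact h5.le
  have hm : ∀ n, ∫ x, x ^ n ∂ν = p.coeff n := fun n => by
    rw [integral_pow_eq_of_eventually hν (key n).1 (hG n).continuousAt (key n).2,
      ← (hG n).coeff_zero 1, ← FormalMultilinearSeries.coeff,
      FormalMultilinearSeries.coeff_iterate_fslope, zero_add]
  obtain ⟨C, R, -, hR, hC⟩ := exists_coeff_bound hp
  exact ⟨R + 1, measure_compl_Icc_eq_zero_of_moment_bound hR (fun n => (key n).1)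
    (fun n => by rw [hm]; exact hC n)⟩

theorem exists_compact_support_of_analytic_left [IsFiniteMeasure ν] (hb : 0 ≤ b) (hν : ∀ᵐ x ∂ν, -b ≤ x) {F : ℝ → ℝ}
    (hF : AnalyticAt ℝ F 0) (h : ∀ᶠ θ in 𝓝[<] 0, M ν θ = F θ) : ∃ R, ν (Icc (-R) R)ᶜ = 0 := by
  have hneg : AnalyticAt ℝ (fun θ => F (-θ)) 0 :=
    AnalyticAt.fun_comp (by simpa using hF) analyticAt_id.fun_neg
  obtain ⟨R, hR⟩ := exists_compact_support_of_analytic_right (ν := ν.map Neg.neg) hb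
    ((ae_map_iff measurable_neg.aemeasurable measurableSet_Iic).2
      (by filter_upwards [hν] with x hx using by simpa using neg_le.1 hx)) hneg (by
      have ht : Tendsto (fun θ : ℝ => -θ) (𝓝[>] 0) (𝓝[<] 0) := by
        simpa using tendsto_neg_nhdsGT (a := (0 : ℝ))
      filter_upwards [ht.eventually h] with θ hθ
      rw [← hθ, M, M, integral_map measurable_neg.aemeasurable
        (Measurable.aestronglyMeasurable (by fun_prop))]
      simp)
  refine ⟨R, ?_⟩
  rw [Measure.map_apply measurable_neg measurableSet_Icc.compl] at hR
  convert hR using 2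
  ext x
  simp only [mem_compl_iff, mem_Icc, mem_preimage]
  constructor <;> intro h1 h2 <;> exact h1 ⟨by linarith [h2.2], by linarith [h2.1]⟩

end OneSided

/-- `1 - θ x` is bounded away from `0` on the support of `ν`. -/
def IsAdmissible (ν : Measure ℝ) (θ : ℝ) : Prop := ∃ c, 0 < c ∧ ∀ᵐ x ∂ν, c ≤ 1 - θ * x

/-! ### Identities for the kernel family -/

section Kernel

variable {ν : Measure ℝ} {θ : ℝ}

theorem IsAdmissible.integrable_div (hθ : IsAdmissible ν θ) {f : ℝ → ℝ} (hf : Integrable f ν) :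
    Integrable (fun x => f x / (1 - θ * x)) ν := by
  obtain ⟨c, hc, h⟩ := hθ
  refine (hf.norm.const_mul c⁻¹).mono' (hf.1.div₀ (by fun_prop)) ?_
  filter_upwards [h] with x hx
  rw [norm_div, Real.norm_of_nonneg (hc.le.trans hx), div_eq_inv_mul]
  exact mul_le_mul_of_nonneg_right (inv_anti₀ hc hx) (norm_nonneg _)

theorem IsAdmissible.M_pos [IsProbabilityMeasure ν] (hθ : IsAdmissible ν θ) : 0 < M ν θ := by
  have hi := hθ.integrable_div (integrable_const (1 : ℝ))
  obtain ⟨c, hc, h⟩ := hθ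
  have hpos : ∀ᵐ x ∂ν, 0 < 1 / (1 - θ * x) := by
    filter_upwards [h] with x hx
    have : 0 < 1 - θ * x := hc.trans_le hx
    positivity
  rw [M, integral_pos_iff_support_of_nonneg_ae (hpos.mono fun x hx => hx.le) hi]
  rw [pos_iff_ne_zero]
  intro h0
  have : ∀ᵐ x ∂ν, x ∉ Function.support fun x => 1 / (1 - θ * x) :=
    measure_eq_zero_iff_ae_notMem.1 h0
  obtain ⟨x, hx1, hx2⟩ := (hpos.and this).exists
  exact hx2 hx1.ne'

theorem IsAdmissible.integral_P [IsProbabilityMeasure ν] (hθ : IsAdmissible ν θ) (f : ℝ → ℝ) :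
    ∫ x, f x ∂(P ν θ) = (∫ x, f x / (1 - θ * x) ∂ν) / M ν θ := by
  have hM := hθ.M_pos
  obtain ⟨c, hc, h⟩ := hθ
  rw [P, integral_withDensity_eq_integral_toReal_smul (by fun_prop)
    (Eventually.of_forall fun x => ENNReal.ofReal_lt_top), ← integral_div]
  refine integral_congr_ae ?_
  filter_upwards [h] with x hx
  have : 0 < 1 - θ * x := hc.trans_le hx
  rw [ENNReal.toReal_ofReal (by positivity), smul_eq_mul]
  field_simp

theorem IsAdmissible.integral_P_one [IsProbabilityMeasure ν] (hθ : IsAdmissible ν θ) : ∫ _, (1 : ℝ) ∂(P ν θ) = 1 := by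
  rw [hθ.integral_P, ← M, div_self hθ.M_pos.ne']

/-- Comes from `1/(1 - θx) = 1 + θx/(1 - θx)`. With `f = 1` it relates `M ν` to the mean, and with
`f = x` the mean to the second moment. -/
theorem IsAdmissible.integral_div_eq (hθ : IsAdmissible ν θ) {f : ℝ → ℝ} (hf : Integrable f ν)
    (hf' : Integrable (fun x => x * f x) ν) :
    ∫ x, f x / (1 - θ * x) ∂ν = ∫ x, f x ∂ν + θ * ∫ x, x * f x / (1 - θ * x) ∂ν := by
  have h2 := hθ.integrable_div hf'
  rw [← integral_const_mul, ← integral_add hf (h2.const_mul θ)]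
  obtain ⟨c, hc, h⟩ := hθ
  refine integral_congr_ae ?_
  filter_upwards [h] with x hx
  have : 1 - θ * x ≠ 0 := (hc.trans_le hx).ne'
  field_simp
  ring

theorem IsAdmissible.M_eq [IsProbabilityMeasure ν] (hθ : IsAdmissible ν θ) (h1 : Integrable (fun x => x) ν) :
    M ν θ = 1 + θ * (M ν θ * k ν θ) := by
  have h := hθ.integral_div_eq (integrable_const (1 : ℝ)) (by simpa using h1)
  rw [k, hθ.integral_P, mul_div_cancel₀ _ hθ.M_pos.ne']
  simpa [M] using h

theorem IsAdmissible.mul_integral_sq [IsProbabilityMeasure ν] (hθ : IsAdmissible ν θ) (h1 : Integrable (fun x => x) ν)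
    (h2 : Integrable (fun x => x ^ 2) ν) (h0 : ∫ x, x ∂ν = 0) :
    θ * ∫ x, x ^ 2 ∂(P ν θ) = k ν θ := by
  have h := hθ.integral_div_eq h1 (by simpa [pow_two] using h2)
  rw [h0, zero_add] at h
  rw [k, hθ.integral_P, hθ.integral_P, h, ← mul_div_assoc]
  simp only [pow_two]

theorem IsAdmissible.integrable_P [IsProbabilityMeasure ν] (hθ : IsAdmissible ν θ) {f : ℝ → ℝ} (hf : Integrable f ν) :
    Integrable f (P ν θ) := by
  have hM := hθ.M_pos
  have hi := (hθ.integrable_div hf).div_const (M ν θ)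
  obtain ⟨c, hc, h⟩ := hθ
  rw [P, integrable_withDensity_iff_integrable_smul' (by fun_prop)
    (Eventually.of_forall fun x => ENNReal.ofReal_lt_top)]
  refine hi.congr ?_
  filter_upwards [h] with x hx
  have : 0 < 1 - θ * x := hc.trans_le hx
  rw [ENNReal.toReal_ofReal (by positivity), smul_eq_mul]
  field_simp

theorem IsAdmissible.integral_sub_sq [IsProbabilityMeasure ν] (hθ : IsAdmissible ν θ) (h1 : Integrable (fun x => x) ν)
    (h2 : Integrable (fun x => x ^ 2) ν) :
    ∫ x, (x - k ν θ) ^ 2 ∂(P ν θ) = ∫ x, x ^ 2 ∂(P ν θ) - k ν θ ^ 2 := by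
  have i1 := hθ.integrable_P h1
  have i2 := hθ.integrable_P h2
  have i0 := hθ.integrable_P (integrable_const (1 : ℝ))
  have e : ∀ x, (x - k ν θ) ^ 2 = x ^ 2 - 2 * k ν θ * x + k ν θ ^ 2 * 1 := fun x => by ring
  simp only [e]
  have i3 : Integrable (fun x => x ^ 2 - 2 * k ν θ * x) (P ν θ) := i2.sub (i1.const_mul _)
  rw [integral_add i3 (i0.const_mul _), integral_sub i2 (i1.const_mul _),
    integral_const_mul, integral_const_mul, hθ.integral_P_one, ← k]
  ring

/-- The means of the kernel family determine the parameter. -/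
theorem IsAdmissible.eq_of_k_eq [IsProbabilityMeasure ν] {θ' : ℝ} (hθ : IsAdmissible ν θ) (hθ' : IsAdmissible ν θ')
    (h1 : Integrable (fun x => x) ν)
    (hν : ∀ m : ℝ, ¬ ∀ᵐ x ∂ν, x = m) (h : k ν θ = k ν θ') : θ = θ' := by
  by_contra hne
  set m := k ν θ with hm
  have hsub : ∀ t, IsAdmissible ν t → Integrable (fun x => (x - m) / (1 - t * x)) ν := fun t ht =>
    ht.integrable_div (h1.sub (integrable_const m))
  have hzero : ∀ t, IsAdmissible ν t → k ν t = m → ∫ x, (x - m) / (1 - t * x) ∂ν = 0 := by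
    intro t ht htm
    have e : ∀ x, (x - m) / (1 - t * x) = x / (1 - t * x) - m * (1 / (1 - t * x)) :=
      fun x => by ring
    simp only [e]
    rw [integral_sub (ht.integrable_div h1)
      ((ht.integrable_div (integrable_const (1 : ℝ))).const_mul m), integral_const_mul, ← M]
    rw [k, ht.integral_P, div_eq_iff ht.M_pos.ne'] at htm
    rw [htm, sub_self]
  have i := hsub θ hθ
  have i' := hsub θ' hθ'
  have z := hzero θ hθ rfl
  have z' := hzero θ' hθ' h.symm
  obtain ⟨c, hc, hcx⟩ := hθ
  obtain ⟨c', hc', hcx'⟩ := hθ'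
  -- Both integrals of `(x - m)/(1 - tx)` vanish. Weighted by `1 - tm`, their difference is `θ - θ'`
  -- times an integral with nonnegative integrand, which would force `ν` to be a point mass at `m`.
  have e : (fun x => (1 - θ * m) * ((x - m) / (1 - θ * x)) -
      (1 - θ' * m) * ((x - m) / (1 - θ' * x)))
      =ᵐ[ν] fun x => (θ - θ') * ((x - m) ^ 2 / ((1 - θ * x) * (1 - θ' * x))) := by
    filter_upwards [hcx, hcx'] with x hx hx'
    rw [← mul_div_assoc, ← mul_div_assoc, ← mul_div_assoc,
      div_sub_div _ _ (hc.trans_le hx).ne' (hc'.trans_le hx').ne']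
    congr 1
    ring
  have hint : Integrable (fun x => (x - m) ^ 2 / ((1 - θ * x) * (1 - θ' * x))) ν := by
    have := (((i.const_mul _).sub (i'.const_mul _)).congr e).const_mul (θ - θ')⁻¹
    simpa [inv_mul_cancel_left₀ (sub_ne_zero.2 hne)] using this
  have hI : ∫ x, (x - m) ^ 2 / ((1 - θ * x) * (1 - θ' * x)) ∂ν = 0 := by
    have := integral_congr_ae e
    rw [integral_sub (i.const_mul _) (i'.const_mul _), integral_const_mul, integral_const_mul, z, z',
      integral_const_mul, mul_zero, mul_zero, sub_zero] at this
    exact (mul_eq_zero.1 this.symm).resolve_left (sub_ne_zero.2 hne)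
  rw [integral_eq_zero_iff_of_nonneg_ae _ hint] at hI
  · refine hν m ?_
    filter_upwards [hI, hcx, hcx'] with x h0 hx hx'
    have h3 : 1 - θ * x ≠ 0 := (hc.trans_le hx).ne'
    have h4 : 1 - θ' * x ≠ 0 := (hc'.trans_le hx').ne'
    simp only [Pi.zero_apply, div_eq_zero_iff, mul_eq_zero, h3, h4, or_self, or_false] at h0
    exact sub_eq_zero.1 (pow_eq_zero_iff two_ne_zero |>.1 h0)
  · filter_upwards [hcx, hcx'] with x hx hx'
    have := hc.trans_le hx
    have := hc'.trans_le hx'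
    simp only [Pi.zero_apply]
    positivity

end Kernel

/-! ### Standardized measures and the parameter sets -/

section Standardized

variable {ν : Measure ℝ}

theorem IsStandardized.integrable_id (h : IsStandardized ν) : Integrable (fun x => x) ν :=
  have := h.1
  h.2.1.integrable one_le_two

theorem IsStandardized.integrable_sq (h : IsStandardized ν) : Integrable (fun x => x ^ 2) ν :=
  h.2.1.integrable_sq

theorem IsStandardized.integral_sq (h : IsStandardized ν) : ∫ x, x ^ 2 ∂ν = 1 := by
  have := h.2.2.2
  rw [variance_of_integral_eq_zero aemeasurable_id (by simpa using h.2.2.1)] at this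
  simpa using this

theorem IsStandardized.not_ae_eq (h : IsStandardized ν) (m : ℝ) : ¬ ∀ᵐ x ∂ν, x = m := by
  intro hm
  have := h.1
  have h1 : ∫ x, x ∂ν = m := by rw [integral_congr_ae hm]; simp
  have h2 : ∫ x, x ^ 2 ∂ν = m ^ 2 := by
    rw [integral_congr_ae (g := fun _ => m ^ 2) (by filter_upwards [hm] with x hx; rw [hx])]; simp
  rw [h.2.2.1] at h1
  rw [h.integral_sq, ← h1] at h2
  norm_num at h2

theorem isAdmissible_zero : IsAdmissible ν 0 := ⟨1, one_pos, by simp⟩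

theorem isAdmissible_of_mem_thetaRight (h : BddAbove ν.support) {θ : ℝ} (hθ : θ ∈ thetaRight ν) :
    IsAdmissible ν θ := by
  refine ⟨1 - θ * B ν, by linarith [hθ.2], ?_⟩
  filter_upwards [ν.support_mem_ae] with x hx
  have : x ≤ B ν := (le_csSup h hx).trans (le_max_right _ _)
  nlinarith [hθ.1]

theorem isAdmissible_of_mem_thetaLeft (h : BddBelow ν.support) {θ : ℝ} (hθ : θ ∈ thetaLeft ν) :
    IsAdmissible ν θ := by
  refine ⟨1 - θ * A ν, by linarith [hθ.2], ?_⟩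
  filter_upwards [ν.support_mem_ae] with x hx
  have : A ν ≤ x := (min_le_right _ _).trans (csInf_le h hx)
  nlinarith [hθ.1]

theorem isAdmissible_of_mem_thetaTwoSided (h : IsCompact ν.support) {θ : ℝ}
    (hθ : θ ∈ thetaTwoSided ν) : IsAdmissible ν θ := by
  rcases hθ with (h1 | h1) | h1
  · exact isAdmissible_of_mem_thetaLeft h.bddBelow h1
  · rw [mem_singleton_iff.1 h1]; exact isAdmissible_zero
  · exact isAdmissible_of_mem_thetaRight h.bddAbove h1

theorem eventually_mul_lt_one (a : ℝ) : ∀ᶠ θ in 𝓝 (0 : ℝ), θ * a < 1 := by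
  have : Tendsto (fun θ : ℝ => θ * a) (𝓝 0) (𝓝 (0 * a)) := Continuous.tendsto (by fun_prop) 0
  exact this.eventually (gt_mem_nhds (by simp))

theorem isCompact_support (h : ∃ R, ν (Icc (-R) R)ᶜ = 0) : IsCompact ν.support := by
  obtain ⟨R, hR⟩ := h
  exact isCompact_Icc.of_isClosed_subset Measure.isClosed_support
    (Measure.support_subset_of_isClosed isClosed_Icc hR)

end Standardized

/-! ### Variance functions and the inverse of `m ↦ m / (V m + m²)` -/

section VarianceFunction

variable {ν : Measure ℝ} {V κ : ℝ → ℝ} {Θ : Set ℝ} {l : Filter ℝ}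

/-- The variance function in terms of the mean and the parameter. -/
theorem IsStandardized.mul_variance_add_sq (h : IsStandardized ν) {θ m : ℝ}
    (hθ : IsAdmissible ν θ) (hm : k ν θ = m) :
    θ * (∫ x, (x - m) ^ 2 ∂(P ν θ) + m ^ 2) = m := by
  have := h.1
  subst hm
  rw [hθ.integral_sub_sq h.integrable_id h.integrable_sq, sub_add_cancel,
    hθ.mul_integral_sq h.integrable_id h.integrable_sq h.2.2.1]

theorem IsStandardized.k_zero (h : IsStandardized ν) : k ν 0 = 0 := by
  have := h.1
  rw [← (isAdmissible_zero (ν := ν)).mul_integral_sq h.integrable_id h.integrable_sq h.2.2.1,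
    zero_mul]

theorem IsStandardized.variance_P_zero (h : IsStandardized ν) :
    ∫ x, (x - 0) ^ 2 ∂(P ν 0) = 1 := by
  have := h.1
  rw [(isAdmissible_zero (ν := ν)).integral_P]
  simp [h.integral_sq, M]

/-- If `κ` inverts `m ↦ m / (V m + m²)`, a variance function determines `M_ν`. -/
theorem IsVarianceFunctionAlong.eventually_M_eq (hν : IsStandardized ν)
    (hΘ : ∀ θ ∈ Θ, IsAdmissible ν θ) (h : IsVarianceFunctionAlong l Θ ν V)
    (hW : ∀ᶠ m in l, V m + m ^ 2 ≠ 0) (hκ : Tendsto κ l l)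
    (hinv : ∀ᶠ θ in l, κ θ / (V (κ θ) + κ θ ^ 2) = θ) :
    ∀ᶠ θ in l, M ν θ * (1 - θ * κ θ) = 1 := by
  have := hν.1
  have key : ∀ᶠ m in l, IsAdmissible ν (m / (V m + m ^ 2)) ∧ k ν (m / (V m + m ^ 2)) = m := by
    filter_upwards [h, hW] with m ⟨hm, hVm⟩ hWm
    have hmem : psi Θ ν m ∈ Θ := Function.invFunOn_mem hm
    have hk : k ν (psi Θ ν m) = m := Function.invFunOn_eq hm
    have hv := hν.mul_variance_add_sq (hΘ _ hmem) hk
    rw [← Q, ← varianceFunction, ← hVm] at hv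
    rw [← eq_div_iff hWm] at hv
    rw [← hv]
    exact ⟨hΘ _ hmem, hk⟩
  filter_upwards [hκ.eventually key, hinv] with θ ⟨ha, hk⟩ hθ
  rw [hθ] at ha hk
  have := ha.M_eq hν.integrable_id
  rw [hk] at this
  linarith

/-- If `κ` inverts `m ↦ m / (V m + m²)` and agrees with the mean function, then `V` is the variance
function. -/
theorem isVarianceFunctionAlong_of_k_eq (hν : IsStandardized ν)
    (hΘ : ∀ θ ∈ Θ, IsAdmissible ν θ) (hl : l ≤ 𝓝 0) (hV : AnalyticAt ℝ V 0) (hV0 : V 0 = 1)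
    (hinv : ∀ᶠ m in 𝓝 0, κ (m / (V m + m ^ 2)) = m) (hk : ∀ᶠ θ in 𝓝 0, k ν θ = κ θ)
    (hmem : ∀ᶠ m in l, m / (V m + m ^ 2) ∈ Θ) : IsVarianceFunctionAlong l Θ ν V := by
  have := hν.1
  have hWc : ContinuousAt (fun m => V m + m ^ 2) 0 := hV.continuousAt.add (by fun_prop)
  have hW : ∀ᶠ m in 𝓝 0, V m + m ^ 2 ≠ 0 := hWc.eventually_ne (by simp [hV0])
  have hg : Tendsto (fun m => m / (V m + m ^ 2)) (𝓝 0) (𝓝 0) := by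
    have : ContinuousAt (fun m => m / (V m + m ^ 2)) 0 :=
      continuousAt_id.div hWc (by simp [hV0])
    simpa using this.tendsto
  filter_upwards [hmem, hl hinv, hl hW, hl (hg.eventually hk)] with m hm h1 h2 h3
  set θ := m / (V m + m ^ 2) with hθ
  rw [h1] at h3
  have hdom : m ∈ domainOfMeans Θ ν := ⟨θ, hm, h3⟩
  refine ⟨hdom, ?_⟩
  -- `psi` is only some chosen preimage of `m`; injectivity of the mean function identifies it.
  have hpsi : psi Θ ν m = θ :=
    (hΘ _ (Function.invFunOn_mem hdom)).eq_of_k_eq (hΘ _ hm) hν.integrable_id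
      hν.not_ae_eq ((Function.invFunOn_eq hdom).trans h3.symm)
  rw [varianceFunction, Q, hpsi]
  -- At `m = 0` the identity `θ * (V m + m²) = m` reads `0 = 0`, so the value there comes from `V 0
  -- = 1`.
  by_cases hm0 : m = 0
  · have hθ0 : θ = 0 := by rw [hθ, hm0, zero_div]
    rw [hθ0, hm0, hν.variance_P_zero, hV0]
  · have hv := hν.mul_variance_add_sq (hΘ _ hm) h3
    have hθ0 : θ ≠ 0 := div_ne_zero hm0 h2
    have e : θ * (V m + m ^ 2) = m := div_mul_cancel₀ _ h2
    exact add_right_cancel (mul_left_cancel₀ hθ0 (e.trans hv.symm))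

end VarianceFunction

/-! ### Passing between `ν` and `ρ` -/

section Equivalence

variable {V : ℝ → ℝ}

theorem analyticAt_add_sq (hV : AnalyticAt ℝ V 0) : AnalyticAt ℝ (fun m => V m + m ^ 2) 0 :=
  hV.fun_add (analyticAt_id.fun_pow 2)

/-- A local inverse of `m ↦ m / W m` with `W 0 > 0` preserves the sign near `0`. -/
theorem eventually_pos_comp {W κ : ℝ → ℝ} (hW : ContinuousAt W 0) (hW0 : 0 < W 0)
    (hκ : ContinuousAt κ 0) (hκ0 : κ 0 = 0) : ∀ᶠ θ in 𝓝 0, 0 < W (κ θ) := by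
  have : Tendsto κ (𝓝 0) (𝓝 0) := by simpa [hκ0] using hκ.tendsto
  exact this.eventually (hW.eventually (lt_mem_nhds hW0))

theorem tendsto_nhdsGT_of_rightInverse {W κ : ℝ → ℝ} (hW : ContinuousAt W 0) (hW0 : 0 < W 0)
    (hκ : ContinuousAt κ 0) (hκ0 : κ 0 = 0) (hinv : ∀ᶠ θ in 𝓝 0, κ θ / W (κ θ) = θ) :
    Tendsto κ (𝓝[>] 0) (𝓝[>] 0) := by
  have h0 : Tendsto κ (𝓝 0) (𝓝 0) := by simpa [hκ0] using hκ.tendsto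
  refine tendsto_nhdsWithin_iff.2 ⟨h0.mono_left nhdsWithin_le_nhds, ?_⟩
  filter_upwards [nhdsWithin_le_nhds hinv, self_mem_nhdsWithin,
    nhdsWithin_le_nhds (eventually_pos_comp hW hW0 hκ hκ0)] with θ h1 h2 h3
  rw [div_eq_iff h3.ne'] at h1
  rw [h1]
  exact mul_pos h2 h3

theorem tendsto_nhdsLT_of_rightInverse {W κ : ℝ → ℝ} (hW : ContinuousAt W 0) (hW0 : 0 < W 0)
    (hκ : ContinuousAt κ 0) (hκ0 : κ 0 = 0) (hinv : ∀ᶠ θ in 𝓝 0, κ θ / W (κ θ) = θ) :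
    Tendsto κ (𝓝[<] 0) (𝓝[<] 0) := by
  have h0 : Tendsto κ (𝓝 0) (𝓝 0) := by simpa [hκ0] using hκ.tendsto
  refine tendsto_nhdsWithin_iff.2 ⟨h0.mono_left nhdsWithin_le_nhds, ?_⟩
  filter_upwards [nhdsWithin_le_nhds hinv, self_mem_nhdsWithin,
    nhdsWithin_le_nhds (eventually_pos_comp hW hW0 hκ hκ0)] with θ h1 h2 h3
  rw [div_eq_iff h3.ne'] at h1
  rw [h1]
  exact mul_neg_of_neg_of_pos h2 h3

/-- The measure `ρ` of a compactly supported `ν` whose transform is given by the local inverse. -/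
theorem exists_moment_measure {κ : ℝ → ℝ} {ν : Measure ℝ} (hν : IsStandardized ν)
    (hc : ∃ R, ν (Icc (-R) R)ᶜ = 0) (hV : AnalyticAt ℝ V 0) (hV0 : V 0 = 1)
    (hκ : AnalyticAt ℝ κ 0) (hκ0 : κ 0 = 0) (hinv : ∀ᶠ m in 𝓝 0, κ (m / (V m + m ^ 2)) = m)
    (hM : ∃ᶠ θ in 𝓝[≠] 0, M ν θ * (1 - θ * κ θ) = 1) :
    ∃ ρ : Measure ℝ, IsFiniteMeasure ρ ∧ ∀ n : ℕ, 1 ≤ n →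
      Integrable (fun x : ℝ => x ^ (n - 1)) ρ ∧
      ∫ x, x ^ (n - 1) ∂ρ =
        1 / (n.factorial : ℝ) * iteratedDeriv (n - 1) (fun m : ℝ => (V m + m ^ 2) ^ n) 0 := by
  have := hν.1
  have hMa := (hasFPowerSeriesAt_M hc).analyticAt
  -- Compact support makes both sides analytic at `0`, so equality at points accumulating at `0`,
  -- even from one side, spreads to a full neighbourhood.
  have hMe : ∀ᶠ θ in 𝓝 0, M ν θ * (1 - θ * κ θ) = 1 :=
    (AnalyticAt.frequently_eq_iff_eventually_eq
      (hMa.fun_mul (analyticAt_const.fun_sub (analyticAt_id.fun_mul hκ))) analyticAt_const).1 hM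
  obtain ⟨R, hR⟩ := hc
  obtain ⟨ρ, hρ, hρc, hrec⟩ := exists_measure_moment_recursion_of_mean_zero ν R hR hν.2.2.1
  have hMρ := (hasFPowerSeriesAt_M hρc).analyticAt
  have hκρ : κ =ᶠ[𝓝 0] fun θ => θ * M ρ θ := by
    filter_upwards [hMe, M_eq_of_moment_recursion ⟨R, hR⟩ hρc hν.2.2.1 hrec] with θ h1 h2
    by_cases hθ : θ = 0
    · rw [hθ, hκ0, zero_mul]
    · have hne : M ν θ ≠ 0 := left_ne_zero_of_mul_eq_one h1
      refine mul_left_cancel₀ (mul_ne_zero hne hθ) ?_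
      linear_combination h2 - h1
  refine ⟨ρ, hρ, fun n hn => ?_⟩
  obtain ⟨n, rfl⟩ := Nat.exists_eq_add_of_le' hn
  obtain ⟨S, -, hS⟩ := exists_pos_of_measure_compl_Icc hρc
  rw [Nat.add_sub_cancel]
  refine ⟨integrable_pow_of_ae_abs_le hS n, ?_⟩
  rw [← iteratedDeriv_succ_of_leftInverse (analyticAt_add_sq hV) (by simp [hV0]) hκ hinv,
    hκρ.iteratedDeriv_eq, iteratedDeriv_succ_id_mul hMρ, iteratedDeriv_M hρc, Nat.factorial_succ]
  push_cast
  field_simp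

/-- The measure `ν` built from `ρ`, with mean function the local inverse. -/
theorem exists_standardized_of_moment_measure {κ : ℝ → ℝ} {ρ : Measure ℝ} [IsFiniteMeasure ρ]
    (hV : AnalyticAt ℝ V 0) (hV0 : V 0 = 1) (hκ : AnalyticAt ℝ κ 0) (hκ0 : κ 0 = 0)
    (hinv : ∀ᶠ m in 𝓝 0, κ (m / (V m + m ^ 2)) = m)
    (hρ : ∀ n : ℕ, 1 ≤ n → Integrable (fun x : ℝ => x ^ (n - 1)) ρ ∧
      ∫ x, x ^ (n - 1) ∂ρ =
        1 / (n.factorial : ℝ) * iteratedDeriv (n - 1) (fun m : ℝ => (V m + m ^ 2) ^ n) 0) :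
    ∃ ν : Measure ℝ, IsStandardized ν ∧ (∃ R, ν (Icc (-R) R)ᶜ = 0) ∧
      ∀ᶠ θ in 𝓝 0, k ν θ = κ θ := by
  have hκp := hκ.hasFPowerSeriesAt
  have hm : ∀ n : ℕ, ∫ x, x ^ n ∂ρ = iteratedDeriv (n + 1) κ 0 / (n + 1).factorial := fun n => by
    rw [iteratedDeriv_succ_of_leftInverse (analyticAt_add_sq hV) (by simp [hV0]) hκ hinv]
    have := (hρ (n + 1) (by omega)).2
    rw [Nat.add_sub_cancel] at this
    rw [this]
    ring
  -- The case `n = 1` of the moment condition gives `ρ` total mass `V 0 = 1`, which becomes the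
  -- variance of `ν`.
  have hρ0 : ∫ x, x ^ 0 ∂ρ = 1 := by
    have := (hρ 1 le_rfl).2
    simpa [hV0] using this
  obtain ⟨C, R, hC, hR, hCR⟩ := exists_coeff_bound hκp
  -- The moments of `ρ` are the Taylor coefficients of `κ` shifted by one, hence the constant `C *
  -- R`.
  have hρc : ∃ R, ρ (Icc (-R) R)ᶜ = 0 :=
    ⟨R + 1, measure_compl_Icc_eq_zero_of_moment_bound (C := C * R) hR
      (fun n => (hρ (n + 1) (by omega)).1) fun n => by
        have := hCR (n + 1)
        rw [FormalMultilinearSeries.coeff_ofScalars] at this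
        rw [hm, mul_assoc, ← pow_succ']
        exact this⟩
  obtain ⟨S, hS⟩ := hρc
  obtain ⟨ν, hν, hνc, hν0, hrec⟩ := exists_measure_moment_recursion ρ S hS
  have hMρ := (hasFPowerSeriesAt_M ⟨S, hS⟩).analyticAt
  have hκρ : κ =ᶠ[𝓝 0] fun θ => θ * M ρ θ := by
    refine eventuallyEq_of_iteratedDeriv_eq hκ (analyticAt_id.fun_mul hMρ) fun n => ?_
    rcases n with _ | n
    · simp [hκ0]
    · have h1 := iteratedDeriv_succ_id_mul hMρ n
      rw [iteratedDeriv_M ⟨S, hS⟩, hm, Nat.factorial_succ] at h1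
      refine Eq.trans ?_ h1.symm
      push_cast
      field_simp
  obtain ⟨T, hT0, hT⟩ := exists_pos_of_measure_compl_Icc hνc
  have hL2 : MemLp (fun x : ℝ => x) 2 ν := MemLp.of_bound (by fun_prop) T hT
  have hstd : IsStandardized ν := by
    refine ⟨hν, hL2, hν0, ?_⟩
    rw [variance_of_integral_eq_zero aemeasurable_id (by simpa using hν0)]
    have := hrec 0
    have h1 : ρ.real univ = 1 := by simpa using hρ0
    simpa [h1] using this
  refine ⟨ν, hstd, hνc, ?_⟩
  have hadm : ∀ᶠ θ in 𝓝 0, IsAdmissible ν θ := by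
    filter_upwards [eventually_abs_mul_lt_one T] with θ hθ
    refine ⟨1 - |θ| * T, by linarith, ?_⟩
    filter_upwards [hT] with x hx
    have h1 : θ * x ≤ |θ| * |x| := (le_abs_self _).trans (abs_mul θ x).le
    have h2 : |θ| * |x| ≤ |θ| * T := mul_le_mul_of_nonneg_left hx (abs_nonneg _)
    linarith
  filter_upwards [hadm, hκρ, M_eq_of_moment_recursion hνc ⟨S, hS⟩ hν0 hrec] with θ h1 h2 h3
  by_cases hθ : θ = 0
  · rw [hθ, hstd.k_zero, hκ0]
  · have h4 := h1.M_eq hstd.integrable_id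
    refine mul_left_cancel₀ (mul_ne_zero h1.M_pos.ne' hθ) ?_
    rw [h2]
    linear_combination h3 - h4

end Equivalence

end CSK

/-! ### The equivalence, with every implication passing through (ii) -/

theorem mainTheorem8 (V : ℝ → ℝ) (hV : AnalyticAt ℝ V 0) (hV0 : V 0 = 1) :
    List.TFAE [
      ∃ ν : Measure ℝ, CSK.IsStandardized ν ∧ CSK.IsVarianceFunctionTwoSided ν V,
      ∃ ν : Measure ℝ, CSK.IsStandardized ν ∧ CSK.IsVarianceFunctionRight ν V,
      ∃ ν : Measure ℝ, CSK.IsStandardized ν ∧ CSK.IsVarianceFunctionLeft ν V,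
      ∃ ρ : Measure ℝ, IsFiniteMeasure ρ ∧ ∀ n : ℕ, 1 ≤ n →
        Integrable (fun x : ℝ => x ^ (n - 1)) ρ ∧
        ∫ x, x ^ (n - 1) ∂ρ =
          1 / (n.factorial : ℝ) * iteratedDeriv (n - 1) (fun m : ℝ => (V m + m ^ 2) ^ n) 0] := by
  have hWa := CSK.analyticAt_add_sq hV
  have hW0 : 0 < V 0 + 0 ^ 2 := by simp [hV0]
  have hWpos : ∀ᶠ m in 𝓝 0, 0 < V m + m ^ 2 :=
    hWa.continuousAt.eventually (lt_mem_nhds hW0)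
  have hWne : ∀ᶠ m in 𝓝 0, V m + m ^ 2 ≠ 0 := hWpos.mono fun m hm => hm.ne'
  obtain ⟨κ, hκ, hκ0, hl, hr⟩ := CSK.exists_analyticAt_localInverse hWa hW0.ne'
  have hgt : Tendsto κ (𝓝[>] 0) (𝓝[>] 0) :=
    CSK.tendsto_nhdsGT_of_rightInverse hWa.continuousAt hW0 hκ.continuousAt hκ0 hr
  have hlt : Tendsto κ (𝓝[<] 0) (𝓝[<] 0) :=
    CSK.tendsto_nhdsLT_of_rightInverse hWa.continuousAt hW0 hκ.continuousAt hκ0 hr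
  have hgtne : 𝓝[>] (0 : ℝ) ≤ 𝓝[≠] 0 := nhdsWithin_mono _ fun x hx => ne_of_gt hx
  have hltne : 𝓝[<] (0 : ℝ) ≤ 𝓝[≠] 0 := nhdsWithin_mono _ fun x hx => ne_of_lt hx
  have hg : Tendsto (fun m => m / (V m + m ^ 2)) (𝓝 0) (𝓝 0) := by
    have : ContinuousAt (fun m => m / (V m + m ^ 2)) 0 :=
      continuousAt_id.div hWa.continuousAt hW0.ne'
    simpa using this.tendsto
  -- The analytic continuation through `0` of `M ν`, which in the one-sided cases is known to have
  -- this form on one side only.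
  have hF : AnalyticAt ℝ (fun θ => (1 - θ * κ θ)⁻¹) 0 :=
    (analyticAt_const.fun_sub (analyticAt_id.fun_mul hκ)).fun_inv (by simp)
  tfae_have 1 → 4 := by
    rintro ⟨ν, hν, hc, hvar⟩
    rw [hν.2.2.1] at hvar
    have hM := CSK.IsVarianceFunctionAlong.eventually_M_eq hν
      (fun θ hθ => CSK.isAdmissible_of_mem_thetaTwoSided hc hθ) hvar hWne
      (by simpa [hκ0] using hκ.continuousAt.tendsto) hr
    obtain ⟨R, hR⟩ := hc.isBounded.subset_closedBall 0
    rw [Real.closedBall_eq_Icc, zero_sub, zero_add] at hR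
    exact CSK.exists_moment_measure hν
      ⟨R, mem_of_superset (Measure.support_mem_ae (μ := ν)) hR⟩ hV hV0 hκ hκ0 hl
      (Eventually.filter_mono nhdsWithin_le_nhds hM).frequently
  tfae_have 2 → 4 := by
    rintro ⟨ν, hν, hb, hvar⟩
    have := hν.1
    rw [hν.2.2.1] at hvar
    have hM := CSK.IsVarianceFunctionAlong.eventually_M_eq hν
      (fun θ hθ => CSK.isAdmissible_of_mem_thetaRight hb hθ) hvar
      (nhdsWithin_le_nhds hWne) hgt (nhdsWithin_le_nhds hr)
    refine CSK.exists_moment_measure hν ?_ hV hV0 hκ hκ0 hl (hM.frequently.filter_mono hgtne)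
    refine CSK.exists_compact_support_of_analytic_right (b := CSK.B ν) (le_max_left _ _) ?_ hF
      (hM.mono fun θ hθ => eq_inv_of_mul_eq_one_left hθ)
    filter_upwards [ν.support_mem_ae] with x hx
    exact (le_csSup hb hx).trans (le_max_right _ _)
  tfae_have 3 → 4 := by
    rintro ⟨ν, hν, hb, hvar⟩
    have := hν.1
    rw [hν.2.2.1] at hvar
    have hM := CSK.IsVarianceFunctionAlong.eventually_M_eq hν
      (fun θ hθ => CSK.isAdmissible_of_mem_thetaLeft hb hθ) hvar
      (nhdsWithin_le_nhds hWne) hlt (nhdsWithin_le_nhds hr)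
    refine CSK.exists_moment_measure hν ?_ hV hV0 hκ hκ0 hl (hM.frequently.filter_mono hltne)
    refine CSK.exists_compact_support_of_analytic_left (b := -CSK.A ν)
      (neg_nonneg.2 (min_le_left _ _)) ?_ hF (hM.mono fun θ hθ => eq_inv_of_mul_eq_one_left hθ)
    filter_upwards [ν.support_mem_ae] with x hx
    rw [neg_neg]
    exact (min_le_right _ _).trans (csInf_le hb hx)
  tfae_have 4 → 1 := by
    rintro ⟨ρ, hρ, hmom⟩
    obtain ⟨ν, hν, hc, hk⟩ := CSK.exists_standardized_of_moment_measure hV hV0 hκ hκ0 hl hmom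
    have hcs := CSK.isCompact_support hc
    refine ⟨ν, hν, hcs, ?_⟩
    rw [hν.2.2.1]
    refine CSK.isVarianceFunctionAlong_of_k_eq hν
      (fun θ hθ => CSK.isAdmissible_of_mem_thetaTwoSided hcs hθ) le_rfl hV hV0 hl hk ?_
    filter_upwards [hg.eventually (CSK.eventually_mul_lt_one (CSK.A ν)),
      hg.eventually (CSK.eventually_mul_lt_one (CSK.B ν))] with m hA hB
    rcases lt_trichotomy (m / (V m + m ^ 2)) 0 with h | h | h
    · exact Or.inl (Or.inl ⟨h, hA⟩)
    · exact Or.inl (Or.inr h)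
    · exact Or.inr ⟨h, hB⟩
  tfae_have 4 → 2 := by
    rintro ⟨ρ, hρ, hmom⟩
    obtain ⟨ν, hν, hc, hk⟩ := CSK.exists_standardized_of_moment_measure hV hV0 hκ hκ0 hl hmom
    have hcs := (CSK.isCompact_support hc).bddAbove
    refine ⟨ν, hν, hcs, ?_⟩
    rw [hν.2.2.1]
    refine CSK.isVarianceFunctionAlong_of_k_eq hν
      (fun θ hθ => CSK.isAdmissible_of_mem_thetaRight hcs hθ) nhdsWithin_le_nhds hV hV0 hl hk ?_
    filter_upwards [nhdsWithin_le_nhds (hg.eventually (CSK.eventually_mul_lt_one (CSK.B ν))),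
      nhdsWithin_le_nhds hWpos, self_mem_nhdsWithin] with m hB hW hm
    exact ⟨div_pos hm hW, hB⟩
  tfae_have 4 → 3 := by
    rintro ⟨ρ, hρ, hmom⟩
    obtain ⟨ν, hν, hc, hk⟩ := CSK.exists_standardized_of_moment_measure hV hV0 hκ hκ0 hl hmom
    have hcs := (CSK.isCompact_support hc).bddBelow
    refine ⟨ν, hν, hcs, ?_⟩
    rw [hν.2.2.1]
    refine CSK.isVarianceFunctionAlong_of_k_eq hν
      (fun θ hθ => CSK.isAdmissible_of_mem_thetaLeft hcs hθ) nhdsWithin_le_nhds hV hV0 hl hk ?_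
    filter_upwards [nhdsWithin_le_nhds (hg.eventually (CSK.eventually_mul_lt_one (CSK.A ν))),
      nhdsWithin_le_nhds hWpos, self_mem_nhdsWithin] with m hA hW hm
    exact ⟨div_neg_of_neg_of_pos hm hW, hA⟩
  tfae_finish
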